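/- Let $1\le p\le 2$, let $f\in L_p(0,1)$ be a real random variable with $\int_0^1 f=0$, and let $M:[0,\infty)\to[0,\infty)$ be an Orlicz function, that is, an increasing convex bijection with $M(0)=0$, normalized by $M(1)=1$. Let $\{f_k\}_{k\ge1}$ be a sequence of independent copies of $f$ (independent random variables on a probability space, each with the same distribution as $f$). Then the following are equivalent. (a) $\{f_k\}$ is equivalent in $L_p$ to the unit vector basis $\{e_k\}$ of the Orlicz sequence space $l_M$, i.e. there is a constant $C>0$ such that for every finitely supported real sequence $a=(a_k)$ $$C^{-1}\Big\|\sum_k a_kf_k\Big\|_{p}\le \Big\|\sum_k a_ke_k\Big\|_{l_M}\le C\Big\|\sum_k a_kf_k\Big\|_{p},$$ where $\|a\|_{l_M}=\inf\{\rho>0:\ \sum_k M(|a_k|/\rho)\le1\}$. (b) There is a constant $C>0$ such that for all $0<t\le 1$ $$C^{-1}\,\frac1{M^{-1}(t)}\le\Big(\frac1t\int_0^tf^*(s)^p\,ds\Big)^{1/p}+\Big(\frac1t\int_t^1f^*(s)^2\,ds\Big)^{1/2}\le C\,\frac1{M^{-1}(t)},$$ where $f^*(s)=\inf\{\tau\ge0:\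 \lambda\{u\in(0,1):|f(u)|>\tau\}\le s\}$ is the non-increasing rearrangement of $f$ and $\lambda$ is Lebesgue measure. -/

import Mathlib

open MeasureTheory ProbabilityTheory Set

noncomputable section

/-- Orlicz functions, normalized as usual: `M : [0,∞) → [0,∞)` is an increasing convex bijection
with `M 0 = 0` and `M 1 = 1`. Only the values of `M` on `[0,∞)` matter. -/
structure IsOrliczFunction (M : ℝ → ℝ) : Prop where
  monotoneOn : MonotoneOn M (Ici 0)
  convexOn : ConvexOn ℝ (Ici 0) M
  map_zero : M 0 = 0
  map_one : M 1 = 1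
  bijOn : BijOn M (Ici 0) (Ici 0)

/-- The inverse function `M⁻¹` of a bijection `M : [0,∞) → [0,∞)`. -/
def orliczInverse (M : ℝ → ℝ) (t : ℝ) : ℝ :=
  Function.invFunOn M (Ici 0) t

/-- The (Luxemburg) norm of the Orlicz sequence space `l_M`:
`‖a‖ = inf {ρ > 0 : ∑ M(|a n| / ρ) ≤ 1}`. The sum of nonnegative terms is taken in `[0,∞]`. -/
def orliczSeqNorm (M : ℝ → ℝ) (a : ℕ → ℝ) : ℝ :=
  sInf {ρ : ℝ | 0 < ρ ∧ ∑' n, ENNReal.ofReal (M (|a n| / ρ)) ≤ 1}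

/-- The distribution function `n_f(τ) = ν {u : |f u| > τ}`. -/
def distributionFn {Ω : Type*} [MeasurableSpace Ω] (ν : Measure Ω) (f : Ω → ℝ) (τ : ℝ) : ENNReal :=
  ν {u | τ < |f u|}

/-- The non-increasing right-continuous rearrangement `f*(s) = inf {t ≥ 0 : n_f(t) ≤ s}`. -/
def decrRearrangement {Ω : Type*} [MeasurableSpace Ω] (ν : Measure Ω) (f : Ω → ℝ) (s : ℝ) : ℝ :=
  sInf {t : ℝ | 0 ≤ t ∧ distributionFn ν f t ≤ ENNReal.ofReal s}

/-- The norm of `L_p(ν)`. -/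
def lpNormReal {Ω : Type*} [MeasurableSpace Ω] (ν : Measure Ω) (p : ℝ) (g : Ω → ℝ) : ℝ :=
  (eLpNorm g (ENNReal.ofReal p) ν).toReal

/-- `u ∼ v` on `S`: there is a constant `C > 0` with `C⁻¹ u ≤ v ≤ C u` on `S`. -/
def EquivalentOn {α : Type*} (S : Set α) (u v : α → ℝ) : Prop :=
  ∃ C : ℝ, 0 < C ∧ ∀ x ∈ S, C⁻¹ * u x ≤ v x ∧ v x ≤ C * u x

/-- Equivalence of a sequence `x` in `E` (with norm `NE`) and a sequence `y` in `F` (with norm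
`NF`): `‖∑ aₙ xₙ‖ ∼ ‖∑ aₙ yₙ‖` for all finitely supported scalar sequences `a`. -/
def SequencesEquivalent {E F : Type*} [AddCommGroup E] [Module ℝ E] [AddCommGroup F] [Module ℝ F]
    (NE : E → ℝ) (x : ℕ → E) (NF : F → ℝ) (y : ℕ → F) : Prop :=
  EquivalentOn (Set.univ : Set (ℕ →₀ ℝ))
    (fun a => NE (a.sum fun n c => c • x n))
    (fun a => NF (a.sum fun n c => c • y n))

/-- `{X k}` is a sequence of independent copies (on the probability space `(Ω, P)`) of the random
variable `f` on `(Ω₀, ν)`. -/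
structure IsIndependentCopies {Ω Ω₀ : Type*} [MeasurableSpace Ω] [MeasurableSpace Ω₀]
    (X : ℕ → Ω → ℝ) (P : Measure Ω) (f : Ω₀ → ℝ) (ν : Measure Ω₀) : Prop where
  indep : iIndepFun X P
  identDistrib : ∀ k, IdentDistrib (X k) f P ν

/-- Lebesgue measure on `(0,1)`. -/
def unitIntervalMeasure : Measure ℝ :=
  volume.restrict (Ioo (0 : ℝ) 1)

end

/-!
For `1 ≤ p ≤ 2` write `φ(x) = min (x², |x|ᵖ)` (`quadPow`) and `Φ(u) = E φ(u f)`
(`quadPowModular`). Both conditions are equivalent to `M` and `Φ` being comparable, up to dilations,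
near `0`.

The link with sums is a modular form of Rosenthal's inequality: for independent centred `Y k`, the
norm of `∑ Y k` in `L_p` is small if and only if `∑ E φ(Y k)` is. The upper half
(`lpNormReal_sum_le`) is an induction on the number of terms based on the smoothness inequality
`φ(x + y) ≤ φ(x) + φ'(x) y + 6 φ(y)`, in which the linear term has zero expectation. For the lower
half (`sum_integral_quadPow_le_one`), centredness implies that changing signs or dropping terms does
not increase the `L₁` norm by more than a factor `2`. Averaging `E cos (t ∑ ± Y k)` over the signs
gives `∏ E cos (t Y k)`, which is therefore close to `1`, so `∑ E (1 - cos (t Y k))` is small;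
integrating in `t` bounds `∑ E min (1, Y k²)`. The part of `|Y k|ᵖ` where `|Y k| > 1` is then
recovered from the disjoint events on which `Y k` is the only large term.

On the other side, `f*` has the distribution of `|f|`, and splitting at `t` the integral of
`φ(f* / ρ)` shows that the rearrangement expression at `t` is comparable to the `ρ` with
`Φ(1 / ρ) = t` (`rearrangementMean_le_of_quadPowModular_le` and
`quadPowModular_le_of_rearrangementMean_le`).

Consequently, applying the norm equivalence to the sum of the first `⌊1 / t⌋` basis vectors yields
the rearrangement condition at `t`; conversely that condition compares `Φ` with `M`, hence the two
modulars, hence the norms.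
-/

noncomputable section

/-! ### The function `min (x², |x|ᵖ)` -/

/-- The function `min (x², |x|ᵖ)`, which is quadratic near `0` and behaves like `|x|ᵖ` at infinity
when `1 ≤ p ≤ 2`. -/
def quadPow (p x : ℝ) : ℝ := min (x ^ 2) (|x| ^ p)

/-- A supergradient-type slope for `quadPow`: the derivative of `x ↦ x²` where `|x| ≤ 1` and that of
`x ↦ |x|ᵖ` elsewhere. -/
def quadPowSlope (p x : ℝ) : ℝ := if |x| ≤ 1 then 2 * x else p * |x| ^ (p - 2) * x

section QuadPow

variable {p x y c : ℝ}

lemma quadPow_nonneg (p x : ℝ) : 0 ≤ quadPow p x :=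
  le_min (sq_nonneg x) (Real.rpow_nonneg (abs_nonneg x) p)

lemma quadPow_le_sq (p x : ℝ) : quadPow p x ≤ x ^ 2 := min_le_left _ _

lemma quadPow_le_rpow (p x : ℝ) : quadPow p x ≤ |x| ^ p := min_le_right _ _

lemma quadPow_abs (p x : ℝ) : quadPow p |x| = quadPow p x := by simp [quadPow]

lemma quadPow_of_abs_le_one (hp2 : p ≤ 2) (hx : |x| ≤ 1) :
    quadPow p x = x ^ 2 := by
  rcases eq_or_ne x 0 with rfl | h0
  · simp only [quadPow]
    exact min_eq_left (by simpa using Real.rpow_nonneg le_rfl p)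
  · refine min_eq_left ?_
    have := Real.rpow_le_rpow_of_exponent_ge (abs_pos.2 h0) hx hp2
    rwa [Real.rpow_two, sq_abs] at this

lemma quadPow_of_one_le_abs (hp2 : p ≤ 2) (hx : 1 ≤ |x|) :
    quadPow p x = |x| ^ p := by
  refine min_eq_right ?_
  have := Real.rpow_le_rpow_of_exponent_le hx hp2
  rwa [Real.rpow_two, sq_abs] at this

lemma quadPow_zero (hp2 : p ≤ 2) : quadPow p 0 = 0 := by
  rw [quadPow_of_abs_le_one hp2 (by simp)]; simp

lemma rpow_le_one_add_quadPow (hp1 : 1 ≤ p) (hp2 : p ≤ 2) (x : ℝ) :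
    |x| ^ p ≤ 1 + quadPow p x := by
  rcases le_total |x| 1 with h | h
  · have := Real.rpow_le_one (abs_nonneg x) h (by linarith : 0 ≤ p)
    linarith [quadPow_nonneg p x]
  · rw [quadPow_of_one_le_abs hp2 h]; linarith

lemma quadPow_mono (hp1 : 1 ≤ p) (h : |x| ≤ |y|) : quadPow p x ≤ quadPow p y :=
  min_le_min (sq_le_sq.2 h) (Real.rpow_le_rpow (abs_nonneg x) h (by linarith))

lemma quadPow_mul_le_sq_mul (hp2 : p ≤ 2) (hc : 1 ≤ c) (x : ℝ) :
    quadPow p (c * x) ≤ c ^ 2 * quadPow p x := by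
  have hc0 : 0 ≤ c := by linarith
  unfold quadPow
  rw [mul_min_of_nonneg _ _ (sq_nonneg c), mul_pow, abs_mul, abs_of_nonneg hc0,
    Real.mul_rpow hc0 (abs_nonneg x)]
  refine min_le_min le_rfl (mul_le_mul_of_nonneg_right ?_ (Real.rpow_nonneg (abs_nonneg x) p))
  simpa using Real.rpow_le_rpow_of_exponent_le hc hp2

lemma quadPow_mul_le_mul (hp1 : 1 ≤ p) (hc0 : 0 ≤ c) (hc : c ≤ 1) (x : ℝ) :
    quadPow p (c * x) ≤ c * quadPow p x := by
  unfold quadPow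
  rw [mul_min_of_nonneg _ _ hc0, mul_pow, abs_mul, abs_of_nonneg hc0,
    Real.mul_rpow hc0 (abs_nonneg x)]
  refine min_le_min (mul_le_mul_of_nonneg_right (by nlinarith) (sq_nonneg x))
    (mul_le_mul_of_nonneg_right ?_ (Real.rpow_nonneg (abs_nonneg x) p))
  rcases hc0.eq_or_lt with rfl | hc0
  · rw [Real.zero_rpow (by linarith)]
  · simpa using Real.rpow_le_rpow_of_exponent_ge hc0 hc hp1

lemma continuous_quadPow (hp1 : 1 ≤ p) : Continuous (quadPow p) :=
  (continuous_pow 2).min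
    (continuous_abs.rpow_const fun _ => Or.inr (by linarith))

lemma measurable_quadPowSlope (p : ℝ) : Measurable (quadPowSlope p) := by
  unfold quadPowSlope
  refine Measurable.ite (measurableSet_le (by fun_prop) (by fun_prop)) (by fun_prop) ?_
  exact ((measurable_id.abs.pow_const (p - 2)).const_mul p).mul measurable_id

lemma abs_quadPowSlope_le (hp1 : 1 ≤ p) (hp2 : p ≤ 2) (x : ℝ) :
    |quadPowSlope p x| ≤ 2 * |x| := by
  unfold quadPowSlope
  split_ifs with h
  · rw [abs_mul]; norm_num
  · have h1 : |x| ^ (p - 2) ≤ 1 :=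
      Real.rpow_le_one_of_one_le_of_nonpos (not_le.1 h).le (by linarith)
    have h0 := Real.rpow_nonneg (abs_nonneg x) (p - 2)
    rw [abs_mul, abs_mul, abs_of_nonneg h0, abs_of_nonneg (by linarith : 0 ≤ p)]
    refine mul_le_mul_of_nonneg_right ?_ (abs_nonneg x)
    nlinarith

/-- Concavity of `s ↦ min (s, s ^ (p / 2))`, evaluated at squares: the graph of `quadPow` lies
below its tangents in the variable `x²`. -/
lemma quadPow_le_tangent (hp1 : 1 ≤ p) (hp2 : p ≤ 2) (x z : ℝ) :
    quadPow p z ≤ quadPow p x +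
      (if |x| ≤ 1 then 1 else p / 2 * |x| ^ (p - 2)) * (z ^ 2 - x ^ 2) := by
  split_ifs with h
  · rw [quadPow_of_abs_le_one hp2 h]
    linarith [quadPow_le_sq p z]
  · have hx : 1 < |x| := not_le.1 h
    have hx0 : 0 < |x| := by linarith
    rw [quadPow_of_one_le_abs hp2 hx.le]
    refine (quadPow_le_rpow p z).trans ?_
    have key := rpow_one_add_le_one_add_mul_self (s := z ^ 2 / x ^ 2 - 1)
      (by have : 0 ≤ z ^ 2 / x ^ 2 := by positivity
          linarith) (p := p / 2) (by linarith) (by linarith)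
    have e1 : (1 + (z ^ 2 / x ^ 2 - 1)) ^ (p / 2) = |z| ^ p / |x| ^ p := by
      have : (1 + (z ^ 2 / x ^ 2 - 1)) = (|z| / |x|) ^ (2 : ℝ) := by
        rw [Real.rpow_two, div_pow, sq_abs, sq_abs]; ring
      rw [this, ← Real.rpow_mul (by positivity), ← Real.div_rpow (abs_nonneg _) (abs_nonneg _)]
      congr 1; ring
    rw [e1, div_le_iff₀ (by positivity)] at key
    refine key.trans (le_of_eq ?_)
    have e2 : |x| ^ p = |x| ^ (p - 2) * x ^ 2 := by
      rw [← sq_abs x, ← Real.rpow_two, ← Real.rpow_add hx0]; congr 1; ring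
    have hxne : x ≠ 0 := abs_pos.1 hx0
    rw [e2]
    field_simp

/-- A smoothness inequality: up to a constant, `quadPow` controls its own second order Taylor
remainder. Taking expectations for independent centred `x`, `y` kills the linear term. -/
lemma quadPow_add_le (hp1 : 1 ≤ p) (hp2 : p ≤ 2) (x y : ℝ) :
    quadPow p (x + y) ≤ quadPow p x + quadPowSlope p x * y + 6 * quadPow p y := by
  rcases le_total |y| |x| with hyx | hxy
  · refine (quadPow_le_tangent hp1 hp2 x (x + y)).trans ?_
    have hq := quadPow_nonneg p y
    unfold quadPowSlope
    split_ifs with h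
    · rw [quadPow_of_abs_le_one hp2 (hyx.trans h)]
      nlinarith [sq_nonneg y]
    · have hx : 1 < |x| := not_le.1 h
      have hx0 : 0 < |x| := by linarith
      have h0 := Real.rpow_nonneg (abs_nonneg x) (p - 2)
      have key : |x| ^ (p - 2) * y ^ 2 ≤ quadPow p y := by
        rcases le_total |y| 1 with hy | hy
        · rw [quadPow_of_abs_le_one hp2 hy]
          have h1 : |x| ^ (p - 2) ≤ 1 :=
            Real.rpow_le_one_of_one_le_of_nonpos hx.le (by linarith)
          nlinarith [sq_nonneg y]
        · rw [quadPow_of_one_le_abs hp2 hy]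
          have hy0 : 0 < |y| := by linarith
          have e2 : |y| ^ p = |y| ^ (p - 2) * y ^ 2 := by
            rw [← sq_abs y, ← Real.rpow_two, ← Real.rpow_add hy0]; congr 1; ring
          rw [e2]
          exact mul_le_mul_of_nonneg_right
            (Real.rpow_le_rpow_of_nonpos hy0 hyx (by linarith)) (sq_nonneg y)
      have : p / 2 * (|x| ^ (p - 2) * y ^ 2) ≤ 1 * quadPow p y :=
        mul_le_mul (by linarith) key (by positivity) (by norm_num)
      nlinarith
  · have h4 : quadPow p (x + y) ≤ 4 * quadPow p y := by
      refine (quadPow_mono hp1 (y := 2 * y) ?_).trans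
        ((quadPow_mul_le_sq_mul hp2 (by norm_num) y).trans (by norm_num))
      rw [abs_mul, abs_two]
      linarith [abs_add_le x y]
    have hL : |quadPowSlope p x * y| ≤ 2 * quadPow p y := by
      rw [abs_mul]
      unfold quadPowSlope
      split_ifs with h
      · rw [abs_mul, abs_two]
        rcases le_total |y| 1 with hy | hy
        · rw [quadPow_of_abs_le_one hp2 hy, ← sq_abs y]
          nlinarith [abs_nonneg x, abs_nonneg y]
        · rw [quadPow_of_one_le_abs hp2 hy]
          have : |y| ≤ |y| ^ p := by
            simpa using Real.rpow_le_rpow_of_exponent_le hy hp1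
          nlinarith [abs_nonneg x, abs_nonneg y]
      · have hx : 1 < |x| := not_le.1 h
        have hx0 : 0 < |x| := by linarith
        have hy0 : 0 < |y| := by linarith
        rw [quadPow_of_one_le_abs hp2 (hx.le.trans hxy), abs_mul, abs_mul,
          abs_of_nonneg (Real.rpow_nonneg (abs_nonneg x) _), abs_of_nonneg (by linarith : 0 ≤ p)]
        have e1 : |x| ^ (p - 2) * |x| = |x| ^ (p - 1) := by
          rw [← Real.rpow_add_one hx0.ne']; congr 1; ring
        have e2 : |y| ^ (p - 1) * |y| = |y| ^ p := by
          rw [← Real.rpow_add_one hy0.ne']; congr 1; ring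
        rw [mul_assoc p, e1, ← e2, mul_assoc p]
        have : |x| ^ (p - 1) * |y| ≤ |y| ^ (p - 1) * |y| :=
          mul_le_mul_of_nonneg_right
            (Real.rpow_le_rpow hx0.le hxy (by linarith)) hy0.le
        exact mul_le_mul hp2 this (by positivity) (by norm_num)
    have := neg_abs_le (quadPowSlope p x * y)
    linarith [quadPow_nonneg p x]

end QuadPow

/-! ### Trigonometric estimates -/

lemma sin_le_sub_cube_div_nine {x : ℝ} (h0 : 0 ≤ x) (h1 : x ≤ 1) : Real.sin x ≤ x - x ^ 3 / 9 := by
  have h := (abs_le.1 (Real.sin_bound (x := x) (by rwa [abs_of_nonneg h0]))).2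
  rw [abs_of_nonneg h0] at h
  have : x ^ 5 ≤ x ^ 3 := pow_le_pow_of_le_one h0 h1 (by norm_num)
  nlinarith [pow_nonneg h0 3]

lemma min_one_sq_le_one_sub_sinc (x : ℝ) : min 1 (x ^ 2) ≤ 36 * (1 - Real.sinc x) := by
  wlog hx : 0 ≤ x generalizing x
  · simpa using this (-x) (by linarith)
  rcases hx.eq_or_lt with rfl | hx0
  · simp
  have hs : Real.sinc x = Real.sin x / x := Real.sinc_of_ne_zero hx0.ne'
  rw [hs]
  rcases le_total x 1 with h1 | h1
  · refine (min_le_right _ _).trans ?_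
    have : Real.sin x / x ≤ 1 - x ^ 2 / 9 := by
      rw [div_le_iff₀ hx0]
      linarith [sin_le_sub_cube_div_nine hx h1, (by ring : (1 - x ^ 2 / 9) * x = x - x ^ 3 / 9)]
    nlinarith
  · refine (min_le_left _ _).trans ?_
    have : Real.sin x / x ≤ 1 - 1 / 36 := by
      rw [div_le_iff₀ hx0]
      rcases le_total x 2 with h2 | h2
      · -- The double angle formula brings `x` into the range of the cubic bound.
        have e : Real.sin x = 2 * Real.sin (x / 2) * Real.cos (x / 2) := by
          rw [← Real.sin_two_mul]; congr 1; ring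
        have hsin0 : 0 ≤ Real.sin (x / 2) :=
          Real.sin_nonneg_of_nonneg_of_le_pi (by linarith) (by linarith [Real.pi_gt_three])
        have hle : Real.sin x ≤ 2 * Real.sin (x / 2) := by
          rw [e]; nlinarith [Real.cos_le_one (x / 2)]
        have := sin_le_sub_cube_div_nine (x := x / 2) (by linarith) (by linarith)
        nlinarith [mul_le_mul h1 h1 zero_le_one hx0.le]
      · linarith [Real.sin_le_one x]
    linarith

lemma one_sub_abs_le_cos (x : ℝ) : 1 - |x| ≤ Real.cos x := by
  have h1 := Real.one_sub_sq_div_two_le_cos (x := x)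
  have h2 := Real.neg_one_le_cos x
  have h3 := sq_abs x
  rcases le_total |x| 2 with h | h
  · nlinarith [abs_nonneg x]
  · linarith

lemma integral_one_sub_cos_mul (x : ℝ) :
    ∫ t in (0 : ℝ)..1, (1 - Real.cos (t * x)) = 1 - Real.sinc x := by
  rcases eq_or_ne x 0 with rfl | hx
  · simp
  rw [intervalIntegral.integral_sub (by simp) (Continuous.intervalIntegrable (by fun_prop) _ _),
    intervalIntegral.integral_comp_mul_right _ hx, Real.sinc_of_ne_zero hx]
  simp [div_eq_inv_mul]

/-- The product of the cosines is the average of the cosines of all signed sums. -/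
lemma two_pow_mul_prod_cos {ι : Type*} [DecidableEq ι] (s : Finset ι) (x : ι → ℝ) :
    2 ^ s.card * ∏ k ∈ s, Real.cos (x k) =
      ∑ A ∈ s.powerset, Real.cos (∑ k ∈ A, x k - ∑ k ∈ s \ A, x k) := by
  induction s using Finset.induction_on with
  | empty => simp
  | insert a s ha ih =>
    rw [Finset.sum_powerset_insert ha, Finset.card_insert_of_notMem ha, Finset.prod_insert ha,
      ← Finset.sum_add_distrib]
    have : (2 : ℝ) ^ (s.card + 1) * (Real.cos (x a) * ∏ k ∈ s, Real.cos (x k)) =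
        2 * Real.cos (x a) * (2 ^ s.card * ∏ k ∈ s, Real.cos (x k)) := by ring
    rw [this, ih, Finset.mul_sum]
    refine Finset.sum_congr rfl fun A hA => ?_
    have haA : a ∉ A := fun h => ha (Finset.mem_powerset.1 hA h)
    rw [Finset.insert_sdiff_of_notMem _ haA, Finset.sum_insert (by simp [ha]),
      Finset.sum_insert haA, Finset.insert_sdiff_insert, Finset.sdiff_insert_of_notMem ha]
    set u := ∑ k ∈ A, x k
    set v := ∑ k ∈ s \ A, x k
    rw [show u - (x a + v) = (u - v) - x a by ring, show x a + u - v = (u - v) + x a by ring,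
      Real.cos_sub (u - v), Real.cos_add (u - v)]
    ring

/-! ### Sums of independent centred random variables -/

section Independent

variable {Ω : Type*} [MeasurableSpace Ω] {P : Measure Ω}

/-- Adding an independent centred random variable does not decrease the `L₁` norm, because
`|u + v| ≥ |u| + sign u * v`. -/
lemma integral_abs_le_integral_abs_add {U V : Ω → ℝ} (hUV : IndepFun U V P)
    (hU : Integrable U P) (hV : Integrable V P) (hV0 : ∫ ω, V ω ∂P = 0) :
    ∫ ω, |U ω| ∂P ≤ ∫ ω, |U ω + V ω| ∂P := by
  set σ : ℝ → ℝ := fun u => if 0 ≤ u then 1 else -1 with hσ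
  have hσm : Measurable σ := Measurable.ite measurableSet_Ici measurable_const measurable_const
  have hσb : ∀ u, ‖σ u‖ ≤ 1 := fun u => by
    simp only [hσ]; split_ifs <;> simp
  have hpt : ∀ u v : ℝ, |u| + σ u * v ≤ |u + v| := fun u v => by
    simp only [hσ]
    split_ifs with h
    · rw [abs_of_nonneg h]; linarith [le_abs_self (u + v)]
    · rw [abs_of_neg (not_le.1 h)]; linarith [neg_abs_le (u + v)]
  have hσU : AEStronglyMeasurable (fun ω => σ (U ω)) P :=
    (hσm.comp_aemeasurable hU.aemeasurable).aestronglyMeasurable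
  have hint : Integrable (fun ω => σ (U ω) * V ω) P :=
    hV.bdd_mul hσU (ae_of_all _ fun ω => hσb _)
  have hzero : ∫ ω, σ (U ω) * V ω ∂P = 0 := by
    have h1 : IndepFun (fun ω => σ (U ω)) V P := hUV.comp hσm measurable_id
    rw [h1.integral_fun_mul_eq_mul_integral hσU hV.aestronglyMeasurable, hV0, mul_zero]
  calc ∫ ω, |U ω| ∂P = ∫ ω, (|U ω| + σ (U ω) * V ω) ∂P := by
        rw [integral_add hU.abs hint, hzero, add_zero]
    _ ≤ _ := integral_mono (hU.abs.add hint) (hU.add hV).abs fun ω => hpt _ _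

variable {ι : Type*} {X : ι → Ω → ℝ}

lemma indepFun_sum_sum (hX : iIndepFun X P) (hm : ∀ k, AEMeasurable (X k) P)
    {A B : Finset ι} (hAB : Disjoint A B) :
    IndepFun (fun ω => ∑ k ∈ A, X k ω) (fun ω => ∑ k ∈ B, X k ω) P := by
  have h := (hX.indepFun_finset₀ A B hAB hm).comp
    (φ := fun v : A → ℝ => ∑ k, v k) (ψ := fun v : B → ℝ => ∑ k, v k)
    (by fun_prop) (by fun_prop)
  convert h using 1 <;>
  · funext ω
    simp only [Function.comp]
    exact (Finset.sum_coe_sort _ (fun k => X k ω)).symm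

lemma integral_abs_sum_le_of_subset [DecidableEq ι] (hX : iIndepFun X P)
    (hi : ∀ k, Integrable (X k) P)
    (h0 : ∀ k, ∫ ω, X k ω ∂P = 0) {A s : Finset ι} (hA : A ⊆ s) :
    ∫ ω, |∑ k ∈ A, X k ω| ∂P ≤ ∫ ω, |∑ k ∈ s, X k ω| ∂P := by
  have h := integral_abs_le_integral_abs_add
    (indepFun_sum_sum hX (fun k => (hi k).aemeasurable) (A := A) (B := s \ A)
      Finset.disjoint_sdiff)
    (integrable_finsetSum _ fun k _ => hi k) (integrable_finsetSum _ fun k _ => hi k)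
    (by rw [integral_finsetSum _ fun k _ => hi k]; simp [h0])
  refine h.trans (le_of_eq ?_)
  congr 1; funext ω
  rw [add_comm, Finset.sum_sdiff hA]

/-! ### The upper estimate -/

lemma integrable_quadPow [IsFiniteMeasure P] {p : ℝ} (hp1 : 1 ≤ p) {Y : Ω → ℝ}
    (hY : MemLp Y (ENNReal.ofReal p) P) :
    Integrable (fun ω => quadPow p (Y ω)) P := by
  have h := hY.integrable_norm_rpow (by simp; linarith) ENNReal.ofReal_ne_top
  rw [ENNReal.toReal_ofReal (by linarith)] at h
  refine h.mono' ((continuous_quadPow hp1).comp_aestronglyMeasurable hY.1)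
    (ae_of_all _ fun ω => ?_)
  rw [Real.norm_of_nonneg (quadPow_nonneg _ _)]
  exact quadPow_le_rpow p _

lemma integral_quadPow_sum_le [IsProbabilityMeasure P] {p : ℝ} (hp1 : 1 ≤ p) (hp2 : p ≤ 2)
    (hX : iIndepFun X P)
    (hL : ∀ k, MemLp (X k) (ENNReal.ofReal p) P) (h0 : ∀ k, ∫ ω, X k ω ∂P = 0)
    (s : Finset ι) :
    ∫ ω, quadPow p (∑ k ∈ s, X k ω) ∂P ≤ 6 * ∑ k ∈ s, ∫ ω, quadPow p (X k ω) ∂P := by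
  classical
  have hp1' : 1 ≤ ENNReal.ofReal p := by simpa using ENNReal.ofReal_le_ofReal hp1
  have hi : ∀ k, Integrable (X k) P := fun k => (hL k).integrable hp1'
  induction s using Finset.induction_on with
  | empty => simp [quadPow_zero hp2]
  | insert a s ha ih =>
    set S : Ω → ℝ := fun ω => ∑ k ∈ s, X k ω with hS
    have hSL : MemLp S (ENNReal.ofReal p) P := memLp_finsetSum s fun k _ => hL k
    have hSi : Integrable S P := hSL.integrable hp1'
    have hind : IndepFun S (X a) P := by
      simpa using indepFun_sum_sum hX (fun k => (hi k).aemeasurable) (A := s) (B := {a})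
        (by simpa using ha)
    have hind' : IndepFun (fun ω => quadPowSlope p (S ω)) (X a) P :=
      hind.comp (measurable_quadPowSlope p) measurable_id
    have hsl : Integrable (fun ω => quadPowSlope p (S ω)) P := by
      refine (hSi.abs.const_mul 2).mono'
        ((measurable_quadPowSlope p).comp_aemeasurable hSi.aemeasurable).aestronglyMeasurable
        (ae_of_all _ fun ω => ?_)
      exact abs_quadPowSlope_le hp1 hp2 _
    have hprod : Integrable (fun ω => quadPowSlope p (S ω) * X a ω) P :=
      hind'.integrable_mul hsl (hi a)
    have hzero : ∫ ω, quadPowSlope p (S ω) * X a ω ∂P = 0 := by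
      rw [hind'.integral_fun_mul_eq_mul_integral hsl.1 (hi a).1, h0 a, mul_zero]
    have hqS := integrable_quadPow hp1 hSL
    have hqa := integrable_quadPow hp1 (hL a)
    have hadd : Integrable (fun ω => quadPow p (S ω) + quadPowSlope p (S ω) * X a ω) P :=
      hqS.add hprod
    have hq : Integrable (fun ω => quadPow p (S ω + X a ω)) P :=
      integrable_quadPow hp1 (hSL.add (hL a))
    calc ∫ ω, quadPow p (∑ k ∈ insert a s, X k ω) ∂P
        = ∫ ω, quadPow p (S ω + X a ω) ∂P := by
          congr 1; funext ω; rw [Finset.sum_insert ha, add_comm]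
      _ ≤ ∫ ω, (quadPow p (S ω) + quadPowSlope p (S ω) * X a ω + 6 * quadPow p (X a ω)) ∂P :=
          integral_mono hq (hadd.add (hqa.const_mul 6))
            fun ω => quadPow_add_le hp1 hp2 _ _
      _ = ∫ ω, quadPow p (S ω) ∂P + 6 * ∫ ω, quadPow p (X a ω) ∂P := by
          rw [integral_add hadd (hqa.const_mul 6), integral_add hqS hprod, hzero,
            integral_const_mul, add_zero]
      _ ≤ _ := by rw [Finset.sum_insert ha]; linarith

lemma lpNormReal_rpow {p : ℝ} (hp1 : 1 ≤ p) {Y : Ω → ℝ} (hY : MemLp Y (ENNReal.ofReal p) P) :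
    lpNormReal P p Y ^ p = ∫ ω, |Y ω| ^ p ∂P := by
  have hp0 : 0 < p := by linarith
  have h0 : 0 ≤ ∫ ω, |Y ω| ^ p ∂P :=
    integral_nonneg fun ω => Real.rpow_nonneg (abs_nonneg _) _
  unfold lpNormReal
  rw [hY.eLpNorm_eq_integral_rpow_norm (by simpa using hp0) ENNReal.ofReal_ne_top,
    ENNReal.toReal_ofReal hp0.le]
  simp only [Real.norm_eq_abs]
  rw [ENNReal.toReal_ofReal (Real.rpow_nonneg h0 _), ← Real.rpow_mul h0,
    inv_mul_cancel₀ hp0.ne', Real.rpow_one]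

lemma lpNormReal_nonneg (p : ℝ) (Y : Ω → ℝ) : 0 ≤ lpNormReal P p Y := ENNReal.toReal_nonneg

lemma lpNormReal_const_mul (p c : ℝ) (Y : Ω → ℝ) :
    lpNormReal P p (fun ω => c * Y ω) = |c| * lpNormReal P p Y := by
  unfold lpNormReal
  have := eLpNorm_const_smul c Y (ENNReal.ofReal p) P
  rw [show (fun ω => c * Y ω) = c • Y from rfl, this, ENNReal.toReal_mul]
  simp

/-- The upper half of the modular description of sums of independent centred variables: if
`∑ E min (X², |X|ᵖ) ≤ 1` then the sum is bounded in `L_p` by an absolute constant. -/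
theorem lpNormReal_sum_le [IsProbabilityMeasure P] {p : ℝ} (hp1 : 1 ≤ p) (hp2 : p ≤ 2)
    (hX : iIndepFun X P)
    (hL : ∀ k, MemLp (X k) (ENNReal.ofReal p) P) (h0 : ∀ k, ∫ ω, X k ω ∂P = 0)
    (s : Finset ι) (hs : ∑ k ∈ s, ∫ ω, quadPow p (X k ω) ∂P ≤ 1) :
    lpNormReal P p (fun ω => ∑ k ∈ s, X k ω) ≤ 7 := by
  have hSL : MemLp (fun ω => ∑ k ∈ s, X k ω) (ENNReal.ofReal p) P :=
    memLp_finsetSum s fun k _ => hL k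
  have hq := integrable_quadPow hp1 hSL
  have h1 : lpNormReal P p (fun ω => ∑ k ∈ s, X k ω) ^ p ≤ 7 := by
    rw [lpNormReal_rpow hp1 hSL]
    have hi := hSL.integrable_norm_rpow (by simp; linarith) ENNReal.ofReal_ne_top
    rw [ENNReal.toReal_ofReal (by linarith)] at hi
    calc ∫ ω, |∑ k ∈ s, X k ω| ^ p ∂P ≤ ∫ ω, (1 + quadPow p (∑ k ∈ s, X k ω)) ∂P :=
          integral_mono hi ((integrable_const 1).add hq)
            fun ω => rpow_le_one_add_quadPow hp1 hp2 _
      _ = 1 + ∫ ω, quadPow p (∑ k ∈ s, X k ω) ∂P := by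
          rw [integral_add (integrable_const 1) hq]; simp
      _ ≤ 7 := by linarith [integral_quadPow_sum_le hp1 hp2 hX hL h0 s]
  by_contra! hlt
  have := Real.rpow_le_rpow_of_exponent_le
    (x := lpNormReal P p (fun ω => ∑ k ∈ s, X k ω)) (by linarith) hp1
  rw [Real.rpow_one] at this
  linarith

end Independent

/-! ### The lower estimate -/

section Lower

lemma integrable_cos {α : Type*} [MeasurableSpace α] {P : Measure α} [IsFiniteMeasure P]
    {Y : α → ℝ} (hY : AEMeasurable Y P) :
    Integrable (fun ω => Real.cos (Y ω)) P :=
  (integrable_const (1 : ℝ)).mono'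
    (Real.continuous_cos.measurable.comp_aemeasurable hY).aestronglyMeasurable
    (ae_of_all _ fun _ => Real.abs_cos_le_one _)

variable {Ω : Type*} [MeasurableSpace Ω] {P : Measure Ω} [IsProbabilityMeasure P]

lemma one_sub_integral_abs_le_integral_cos {Y : Ω → ℝ} (hY : Integrable Y P) :
    1 - ∫ ω, |Y ω| ∂P ≤ ∫ ω, Real.cos (Y ω) ∂P := by
  calc 1 - ∫ ω, |Y ω| ∂P = ∫ ω, (1 - |Y ω|) ∂P := by
        rw [integral_sub (integrable_const 1) hY.abs]; simp
    _ ≤ _ := integral_mono ((integrable_const 1).sub hY.abs) (integrable_cos hY.aemeasurable)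
        fun ω => one_sub_abs_le_cos _

variable {ι : Type*} {X : ι → Ω → ℝ}

/-- Flipping signs at most doubles the `L₁` norm of a sum of independent centred variables, so
averaging `E cos` over all signs bounds the product of the expectations of the cosines. -/
lemma one_sub_le_prod_integral_cos (hX : iIndepFun X P) (hi : ∀ k, Integrable (X k) P)
    (h0 : ∀ k, ∫ ω, X k ω ∂P = 0) (s : Finset ι) {t : ℝ} (ht0 : 0 ≤ t) (ht1 : t ≤ 1) :
    1 - 2 * ∫ ω, |∑ k ∈ s, X k ω| ∂P ≤ ∏ k ∈ s, ∫ ω, Real.cos (t * X k ω) ∂P := by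
  classical
  set ε := ∫ ω, |∑ k ∈ s, X k ω| ∂P with hε
  have hprod : ∏ k ∈ s, ∫ ω, Real.cos (t * X k ω) ∂P
      = ∫ ω, ∏ k ∈ s, Real.cos (t * X k ω) ∂P := by
    have h := (hX.precomp (g := ((↑) : s → ι)) Subtype.val_injective).integral_fun_prod_comp
      (f := fun _ x => Real.cos (t * x)) (fun k => (hi k).aemeasurable)
      (fun k => Continuous.aestronglyMeasurable (by fun_prop))
    rw [← Finset.prod_coe_sort s, ← h]
    congr 1; funext ω
    exact Finset.prod_coe_sort s (fun k => Real.cos (t * X k ω))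
  have hsub : ∀ A : Finset ι, Integrable (fun ω => ∑ k ∈ A, X k ω) P := fun A =>
    integrable_finsetSum _ fun k _ => hi k
  have hsign : ∀ A ∈ s.powerset,
      1 - 2 * ε ≤ ∫ ω, Real.cos (∑ k ∈ A, t * X k ω - ∑ k ∈ s \ A, t * X k ω) ∂P := by
    intro A hA
    have hdiff : Integrable (fun ω => ∑ k ∈ A, X k ω - ∑ k ∈ s \ A, X k ω) P :=
      (hsub A).sub (hsub _)
    have h1 := one_sub_integral_abs_le_integral_cos (hdiff.const_mul t)
    have h2 : ∫ ω, |t * (∑ k ∈ A, X k ω - ∑ k ∈ s \ A, X k ω)| ∂P ≤ 2 * ε := by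
      calc _ ≤ ∫ ω, (|∑ k ∈ A, X k ω| + |∑ k ∈ s \ A, X k ω|) ∂P := by
            refine integral_mono (hdiff.const_mul t).abs ((hsub A).abs.add (hsub _).abs)
              fun ω => ?_
            simp only [abs_mul, abs_of_nonneg ht0]
            refine (mul_le_of_le_one_left (abs_nonneg _) ht1).trans ?_
            exact abs_sub _ _
        _ = ∫ ω, |∑ k ∈ A, X k ω| ∂P + ∫ ω, |∑ k ∈ s \ A, X k ω| ∂P :=
            integral_add (hsub A).abs (hsub _).abs
        _ ≤ 2 * ε := by
            have := integral_abs_sum_le_of_subset hX hi h0 (Finset.mem_powerset.1 hA)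
            have := integral_abs_sum_le_of_subset hX hi h0 (Finset.sdiff_subset (s := s) (t := A))
            linarith
    simp only [← Finset.mul_sum, ← mul_sub]
    linarith
  have hcos : ∀ A ∈ s.powerset, Integrable
      (fun ω => Real.cos (∑ k ∈ A, t * X k ω - ∑ k ∈ s \ A, t * X k ω)) P := fun A _ =>
    integrable_cos ((integrable_finsetSum _ fun k _ => (hi k).const_mul t).sub
      (integrable_finsetSum _ fun k _ => (hi k).const_mul t)).aemeasurable
  have hmain : 2 ^ s.card * (1 - 2 * ε) ≤
      2 ^ s.card * ∫ ω, ∏ k ∈ s, Real.cos (t * X k ω) ∂P := by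
    rw [← integral_const_mul ((2 : ℝ) ^ s.card)]
    rw [integral_congr_ae (ae_of_all _ fun ω => two_pow_mul_prod_cos s fun k => t * X k ω),
      integral_finsetSum _ hcos]
    refine le_trans (le_of_eq ?_) (Finset.sum_le_sum hsign)
    rw [Finset.sum_const, Finset.card_powerset, nsmul_eq_mul]
    push_cast; ring
  rw [hprod]
  exact le_of_mul_le_mul_left hmain (by positivity)

lemma sum_integral_one_sub_cos_le (hX : iIndepFun X P) (hi : ∀ k, Integrable (X k) P)
    (h0 : ∀ k, ∫ ω, X k ω ∂P = 0) (s : Finset ι)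
    (hs : ∫ ω, |∑ k ∈ s, X k ω| ∂P ≤ 1 / 4) {t : ℝ} (ht0 : 0 ≤ t) (ht1 : t ≤ 1) :
    ∑ k ∈ s, ∫ ω, (1 - Real.cos (t * X k ω)) ∂P ≤ 4 * ∫ ω, |∑ k ∈ s, X k ω| ∂P := by
  classical
  have hmain := one_sub_le_prod_integral_cos hX hi h0 s ht0 ht1
  set ε := ∫ ω, |∑ k ∈ s, X k ω| ∂P with hε
  have hε0 : 0 ≤ ε := integral_nonneg fun ω => abs_nonneg _
  set c : ι → ℝ := fun k => ∫ ω, (1 - Real.cos (t * X k ω)) ∂P with hc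
  have hcos : ∀ k, Integrable (fun ω => Real.cos (t * X k ω)) P := fun k =>
    integrable_cos ((hi k).const_mul t).aemeasurable
  have hc' : ∀ k, ∫ ω, Real.cos (t * X k ω) ∂P = 1 - c k := fun k => by
    simp only [hc]
    rw [integral_sub (integrable_const 1) (hcos k)]; simp
  have hc0 : ∀ k, 0 ≤ c k := fun k =>
    integral_nonneg fun ω => sub_nonneg.2 (Real.cos_le_one _)
  have hc1 : ∀ k ∈ s, 0 ≤ 1 - c k := fun k hk => by
    rw [← hc']
    have h1 := one_sub_integral_abs_le_integral_cos ((hi k).const_mul t)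
    have h2 : ∫ ω, |t * X k ω| ∂P ≤ ε := by
      have h3 := integral_abs_sum_le_of_subset hX hi h0 (Finset.singleton_subset_iff.2 hk)
      simp only [Finset.sum_singleton] at h3
      simp only [abs_mul, abs_of_nonneg ht0, integral_const_mul]
      exact (mul_le_of_le_one_left (integral_nonneg fun ω => abs_nonneg _) ht1).trans h3
    linarith
  have hexp : ∏ k ∈ s, (1 - c k) ≤ Real.exp (-∑ k ∈ s, c k) := by
    rw [← Finset.sum_neg_distrib, Real.exp_sum]
    refine Finset.prod_le_prod hc1 fun k _ => ?_
    linarith [Real.add_one_le_exp (-c k)]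
  simp_rw [hc'] at hmain
  set z := ∑ k ∈ s, c k
  have hz0 : 0 ≤ z := Finset.sum_nonneg fun k _ => hc0 k
  have h1 : 1 - 2 * ε ≤ Real.exp (-z) := hmain.trans hexp
  have h2 : (1 - 2 * ε) * Real.exp z ≤ 1 := by
    calc _ ≤ Real.exp (-z) * Real.exp z := by gcongr
      _ = 1 := by rw [← Real.exp_add]; simp
  nlinarith [Real.add_one_le_exp z]

lemma integral_one_sub_sinc {Y : Ω → ℝ} (hY : AEMeasurable Y P) :
    IntervalIntegrable (fun t => ∫ ω, (1 - Real.cos (t * Y ω)) ∂P) volume 0 1 ∧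
    ∫ ω, (1 - Real.sinc (Y ω)) ∂P = ∫ t in (0 : ℝ)..1, ∫ ω, (1 - Real.cos (t * Y ω)) ∂P := by
  have hint : Integrable (fun z : ℝ × Ω => 1 - Real.cos (z.1 * Y z.2))
      ((volume.restrict (Ioc (0 : ℝ) 1)).prod P) := by
    refine (integrable_const (1 : ℝ)).sub (integrable_cos ?_)
    exact measurable_fst.aemeasurable.mul hY.comp_snd
  refine ⟨(intervalIntegrable_iff_integrableOn_Ioc_of_le zero_le_one).2 hint.integral_prod_left, ?_⟩
  rw [intervalIntegral.integral_of_le zero_le_one, integral_integral_swap hint]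
  simp_rw [← intervalIntegral.integral_of_le (zero_le_one (α := ℝ)), integral_one_sub_cos_mul]

lemma integrable_min_one_sq {Y : Ω → ℝ} (hY : AEMeasurable Y P) :
    Integrable (fun ω => min 1 (Y ω ^ 2)) P := by
  refine (integrable_const (1 : ℝ)).mono'
    (aemeasurable_const.min (hY.pow_const 2)).aestronglyMeasurable (ae_of_all _ fun ω => ?_)
  rw [Real.norm_of_nonneg (le_min zero_le_one (sq_nonneg _))]
  exact min_le_left _ _

/-- Integrating over `t ∈ [0, 1]` replaces `1 - cos (t x)` by `1 - sinc x`, which is bounded below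
by a multiple of `min (1, x²)`. -/
lemma sum_integral_min_one_sq_le (hX : iIndepFun X P) (hi : ∀ k, Integrable (X k) P)
    (h0 : ∀ k, ∫ ω, X k ω ∂P = 0) (s : Finset ι)
    (hs : ∫ ω, |∑ k ∈ s, X k ω| ∂P ≤ 1 / 4) :
    ∑ k ∈ s, ∫ ω, min 1 (X k ω ^ 2) ∂P ≤ 144 * ∫ ω, |∑ k ∈ s, X k ω| ∂P := by
  have hsinc : ∀ k, Integrable (fun ω => 1 - Real.sinc (X k ω)) P := fun k =>
    (integrable_const 1).sub ((integrable_const (1 : ℝ)).mono'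
      (Real.continuous_sinc.measurable.comp_aemeasurable (hi k).aemeasurable).aestronglyMeasurable
      (ae_of_all _ fun ω => Real.abs_sinc_le_one _))
  calc ∑ k ∈ s, ∫ ω, min 1 (X k ω ^ 2) ∂P
      ≤ ∑ k ∈ s, 36 * ∫ ω, (1 - Real.sinc (X k ω)) ∂P := by
        refine Finset.sum_le_sum fun k _ => ?_
        rw [← integral_const_mul]
        exact integral_mono (integrable_min_one_sq (hi k).aemeasurable) ((hsinc k).const_mul _)
          fun ω => min_one_sq_le_one_sub_sinc _
    _ = 36 * ∫ t in (0 : ℝ)..1, ∑ k ∈ s, ∫ ω, (1 - Real.cos (t * X k ω)) ∂P := by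
        rw [intervalIntegral.integral_finsetSum
          fun k _ => (integral_one_sub_sinc (hi k).aemeasurable).1, ← Finset.mul_sum]
        simp_rw [(integral_one_sub_sinc (hi _).aemeasurable).2]
    _ ≤ 36 * ∫ _ in (0 : ℝ)..1, 4 * ∫ ω, |∑ k ∈ s, X k ω| ∂P := by
        gcongr
        refine intervalIntegral.integral_mono_on zero_le_one
          (by simpa only [Finset.sum_fn] using IntervalIntegrable.sum s fun k _ =>
            (integral_one_sub_sinc (hi k).aemeasurable).1)
          (by simp) fun t ht => ?_
        exact sum_integral_one_sub_cos_le hX hi h0 s hs ht.1 ht.2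
    _ = _ := by simp; ring

/-- The function equal to `|x|ᵖ` where `|x| > 1` and to zero elsewhere. -/
def powTail (p x : ℝ) : ℝ := if 1 < |x| then |x| ^ p else 0

lemma powTail_nonneg (p x : ℝ) : 0 ≤ powTail p x := by
  unfold powTail; split_ifs
  · positivity
  · exact le_rfl

lemma measurable_powTail (p : ℝ) : Measurable (powTail p) :=
  Measurable.ite (measurableSet_lt (by fun_prop) (by fun_prop))
    (measurable_id.abs.pow_const p) measurable_const

lemma integrable_powTail {α : Type*} [MeasurableSpace α] {P : Measure α} {p : ℝ} (hp1 : 1 ≤ p)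
    {Y : α → ℝ}
    (hY : MemLp Y (ENNReal.ofReal p) P) : Integrable (fun ω => powTail p (Y ω)) P := by
  have h := hY.integrable_norm_rpow (by simp; linarith) ENNReal.ofReal_ne_top
  rw [ENNReal.toReal_ofReal (by linarith)] at h
  refine h.mono' ((measurable_powTail p).comp_aemeasurable hY.1.aemeasurable).aestronglyMeasurable
    (ae_of_all _ fun ω => ?_)
  rw [Real.norm_of_nonneg (powTail_nonneg _ _)]
  unfold powTail
  split_ifs
  · exact le_rfl
  · positivity

/-- The indicator of the event that a tuple has no entry exceeding `1` in modulus and that its sum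
is at most `1 / 2` in modulus. -/
def smallTuple {κ : Type*} [Fintype κ] (v : κ → ℝ) : ℝ :=
  {v : κ → ℝ | (∀ j, |v j| ≤ 1) ∧ |∑ j, v j| ≤ 1 / 2}.indicator 1 v

lemma measurable_smallTuple {κ : Type*} [Fintype κ] :
    Measurable (smallTuple : (κ → ℝ) → ℝ) := by
  refine Measurable.indicator measurable_const (MeasurableSet.inter ?_ ?_)
  · have : {v : κ → ℝ | ∀ j, |v j| ≤ 1} = ⋂ j, {v : κ → ℝ | |v j| ≤ 1} := by ext; simp
    change MeasurableSet {v : κ → ℝ | ∀ j, |v j| ≤ 1}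
    rw [this]
    exact MeasurableSet.iInter fun j => measurableSet_le (by fun_prop) (by fun_prop)
  · exact measurableSet_le (f := fun v : κ → ℝ => |∑ j, v j|) (by fun_prop) (by fun_prop)

lemma one_sub_le_smallTuple {κ : Type*} [Fintype κ] (v : κ → ℝ) :
    1 - (∑ j, min 1 (v j ^ 2) + 2 * |∑ j, v j|) ≤ smallTuple v := by
  have hn : ∀ j, 0 ≤ min 1 (v j ^ 2) := fun j => le_min zero_le_one (sq_nonneg _)
  have hn' : 0 ≤ ∑ j, min 1 (v j ^ 2) := Finset.sum_nonneg fun j _ => hn j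
  by_cases h : v ∈ {v : κ → ℝ | (∀ j, |v j| ≤ 1) ∧ |∑ j, v j| ≤ 1 / 2}
  · rw [smallTuple, indicator_of_mem h, Pi.one_apply]
    linarith [abs_nonneg (∑ j, v j)]
  · rw [smallTuple, indicator_of_notMem h]
    rw [mem_ofPred_eq, not_and_or] at h
    rcases h with h | h
    · push Not at h
      obtain ⟨j, hj⟩ := h
      have h1 : min 1 (v j ^ 2) = 1 := min_eq_left (by rw [← sq_abs]; exact one_le_pow₀ hj.le)
      have h2 := Finset.single_le_sum (f := fun j => min 1 (v j ^ 2)) (fun j _ => hn j)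
        (Finset.mem_univ j)
      simp only [h1] at h2
      linarith [abs_nonneg (∑ j, v j)]
    · linarith [not_le.1 h]

/-- At most one summand is nonzero, and for that one `x k` is large while the remaining
terms add up to at most `1 / 2`, so that the whole sum is comparable to `x k`. -/
lemma sum_powTail_mul_smallTuple_le [DecidableEq ι] {p : ℝ} (hp1 : 1 ≤ p) (hp2 : p ≤ 2)
    (s : Finset ι) (x : ι → ℝ) :
    ∑ k ∈ s, powTail p (x k) * smallTuple (fun j : s.erase k => x j) ≤
      4 * |∑ k ∈ s, x k| ^ p := by
  by_cases h : ∃ k ∈ s, 1 < |x k| ∧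
      (fun j : s.erase k => x j) ∈ {v : s.erase k → ℝ | (∀ j, |v j| ≤ 1) ∧ |∑ j, v j| ≤ 1 / 2}
  · obtain ⟨k, hk, hxk, hsmall⟩ := h
    have hsmall' := hsmall
    rw [mem_ofPred_eq, Finset.sum_coe_sort (s.erase k) x] at hsmall'
    rw [Finset.sum_eq_single_of_mem k hk]
    · rw [powTail, if_pos hxk, smallTuple, indicator_of_mem hsmall, Pi.one_apply, mul_one]
      have hS : |x k| ≤ 2 * |∑ k ∈ s, x k| := by
        rw [← Finset.add_sum_erase s x hk]
        have := abs_sub_abs_le_abs_sub (x k) (-∑ j ∈ s.erase k, x j)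
        rw [abs_neg, sub_neg_eq_add] at this
        linarith [hsmall'.2]
      calc |x k| ^ p ≤ (2 * |∑ k ∈ s, x k|) ^ p :=
            Real.rpow_le_rpow (abs_nonneg _) hS (by linarith)
        _ = 2 ^ p * |∑ k ∈ s, x k| ^ p := Real.mul_rpow (by norm_num) (abs_nonneg _)
        _ ≤ 4 * |∑ k ∈ s, x k| ^ p := by
            gcongr
            have := Real.rpow_le_rpow_of_exponent_le (one_le_two (α := ℝ)) hp2
            norm_num at this
            exact this
    · intro j hj hjk
      have : ¬ 1 < |x j| := not_lt.2 (hsmall'.1 ⟨j, Finset.mem_erase.2 ⟨hjk, hj⟩⟩)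
      rw [powTail, if_neg this, zero_mul]
  · rw [Finset.sum_eq_zero]
    · positivity
    · intro k hk
      by_cases hxk : 1 < |x k|
      · rw [smallTuple, indicator_of_notMem (fun hm => h ⟨k, hk, hxk, hm⟩), mul_zero]
      · rw [powTail, if_neg hxk, zero_mul]

/-- The large values. When one term exceeds `1`, the remaining terms are, with conditional
probability at least `1 / 2`, all at most `1` and of small sum; these events are disjoint for
different terms. -/
lemma sum_integral_powTail_le {p : ℝ} (hp1 : 1 ≤ p) (hp2 : p ≤ 2)
    (hX : iIndepFun X P)
    (hL : ∀ k, MemLp (X k) (ENNReal.ofReal p) P) (h0 : ∀ k, ∫ ω, X k ω ∂P = 0)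
    (s : Finset ι) (hs1 : ∑ k ∈ s, ∫ ω, min 1 (X k ω ^ 2) ∂P ≤ 1 / 4)
    (hs2 : ∫ ω, |∑ k ∈ s, X k ω| ∂P ≤ 1 / 8) :
    ∑ k ∈ s, ∫ ω, powTail p (X k ω) ∂P ≤ 8 * ∫ ω, |∑ k ∈ s, X k ω| ^ p ∂P := by
  classical
  have hp1' : 1 ≤ ENNReal.ofReal p := by simpa using ENNReal.ofReal_le_ofReal hp1
  have hi : ∀ k, Integrable (X k) P := fun k => (hL k).integrable hp1'
  have hm : ∀ k, AEMeasurable (X k) P := fun k => (hi k).aemeasurable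
  set b : ι → Ω → ℝ := fun k ω => smallTuple (fun j : s.erase k => X j ω) with hb
  have hbm : ∀ k, AEMeasurable (b k) P := fun k =>
    measurable_smallTuple.comp_aemeasurable (aemeasurable_pi_lambda _ fun j => hm j)
  have hb1 : ∀ k ω, ‖b k ω‖ ≤ 1 := fun k ω => by
    simp only [hb, smallTuple, indicator]
    split_ifs <;> simp
  have hbi : ∀ k, Integrable (b k) P := fun k =>
    (integrable_const (1 : ℝ)).mono' (hbm k).aestronglyMeasurable (ae_of_all _ (hb1 k))
  have hmin0 : ∀ k, 0 ≤ ∫ ω, min 1 (X k ω ^ 2) ∂P := fun k =>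
    integral_nonneg fun ω => le_min zero_le_one (sq_nonneg _)
  have hbhalf : ∀ k, 1 / 2 ≤ ∫ ω, b k ω ∂P := fun k => by
    have hi1 : Integrable (fun ω => ∑ j ∈ s.erase k, min 1 (X j ω ^ 2)) P :=
      integrable_finsetSum _ fun j _ => integrable_min_one_sq (hm j)
    have hi2 : Integrable (fun ω => 2 * |∑ j ∈ s.erase k, X j ω|) P :=
      (integrable_finsetSum _ fun j _ => hi j).abs.const_mul 2
    have hi3 : Integrable (fun ω => ∑ j ∈ s.erase k, min 1 (X j ω ^ 2)
        + 2 * |∑ j ∈ s.erase k, X j ω|) P := hi1.add hi2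
    calc (1 : ℝ) / 2 ≤ 1 - (∑ j ∈ s.erase k, ∫ ω, min 1 (X j ω ^ 2) ∂P
          + 2 * ∫ ω, |∑ j ∈ s.erase k, X j ω| ∂P) := by
          have h1 := Finset.sum_le_sum_of_subset_of_nonneg (Finset.erase_subset k s)
            fun j _ _ => hmin0 j
          have h2 := integral_abs_sum_le_of_subset hX hi h0 (Finset.erase_subset k s)
          linarith
      _ = ∫ ω, (1 - (∑ j ∈ s.erase k, min 1 (X j ω ^ 2)
          + 2 * |∑ j ∈ s.erase k, X j ω|)) ∂P := by
          rw [integral_sub (integrable_const 1) hi3, integral_add hi1 hi2, integral_const_mul,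
            integral_finsetSum _ fun j _ => integrable_min_one_sq (hm j)]
          simp
      _ ≤ ∫ ω, b k ω ∂P := by
          refine integral_mono ((integrable_const 1).sub hi3) (hbi k) fun ω => ?_
          have := one_sub_le_smallTuple (fun j : s.erase k => X j ω)
          rwa [Finset.sum_coe_sort (s.erase k) (fun j => X j ω),
            Finset.sum_coe_sort (s.erase k) (fun j => min 1 (X j ω ^ 2))] at this
  have hind : ∀ k, IndepFun (fun ω => powTail p (X k ω)) (b k) P := fun k => by
    have h := (hX.indepFun_finset₀ {k} (s.erase k) (by simp) hm).comp
      (φ := fun v : ({k} : Finset ι) → ℝ => powTail p (v ⟨k, Finset.mem_singleton_self k⟩))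
      (ψ := smallTuple)
      ((measurable_powTail p).comp (measurable_pi_apply _)) measurable_smallTuple
    exact h
  have hTi := fun k => integrable_powTail hp1 (hL k)
  have hprodi : ∀ k, Integrable (fun ω => powTail p (X k ω) * b k ω) P := fun k =>
    (hind k).integrable_mul (hTi k) (hbi k)
  have hSp : Integrable (fun ω => |∑ k ∈ s, X k ω| ^ p) P := by
    have hi := (memLp_finsetSum s fun k _ => hL k).integrable_norm_rpow
      (by simp; linarith) ENNReal.ofReal_ne_top
    rwa [ENNReal.toReal_ofReal (by linarith)] at hi
  have key : ∑ k ∈ s, ∫ ω, powTail p (X k ω) * b k ω ∂P ≤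
      4 * ∫ ω, |∑ k ∈ s, X k ω| ^ p ∂P := by
    rw [← integral_finsetSum _ fun k _ => hprodi k, ← integral_const_mul]
    exact integral_mono (integrable_finsetSum _ fun k _ => hprodi k) (hSp.const_mul 4)
      fun ω => sum_powTail_mul_smallTuple_le hp1 hp2 s fun k => X k ω
  have hhalf : ∑ k ∈ s, (1 / 2) * ∫ ω, powTail p (X k ω) ∂P ≤
      ∑ k ∈ s, ∫ ω, powTail p (X k ω) * b k ω ∂P := by
    refine Finset.sum_le_sum fun k _ => ?_
    rw [(hind k).integral_fun_mul_eq_mul_integral (hTi k).1 (hbi k).1, mul_comm]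
    exact mul_le_mul_of_nonneg_left (hbhalf k) (integral_nonneg fun ω => powTail_nonneg _ _)
  rw [← Finset.mul_sum] at hhalf
  linarith

lemma quadPow_le_min_add_powTail {p : ℝ} (hp2 : p ≤ 2) (x : ℝ) :
    quadPow p x ≤ min 1 (x ^ 2) + powTail p x := by
  unfold powTail
  split_ifs with h
  · linarith [quadPow_le_rpow p x, le_min zero_le_one (sq_nonneg x)]
  · have h1 := not_lt.1 h
    rw [quadPow_of_abs_le_one hp2 h1, min_eq_right, add_zero]
    rw [← sq_abs]
    exact pow_le_one₀ (abs_nonneg x) h1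

/-- The lower half of the modular description of sums of independent centred variables: if the sum
is small in `L_p`, then `∑ E min (X², |X|ᵖ) ≤ 1`. -/
theorem sum_integral_quadPow_le_one {p : ℝ} (hp1 : 1 ≤ p) (hp2 : p ≤ 2)
    (hX : iIndepFun X P)
    (hL : ∀ k, MemLp (X k) (ENNReal.ofReal p) P) (h0 : ∀ k, ∫ ω, X k ω ∂P = 0)
    (s : Finset ι) (hs : lpNormReal P p (fun ω => ∑ k ∈ s, X k ω) ≤ 1 / 600) :
    ∑ k ∈ s, ∫ ω, quadPow p (X k ω) ∂P ≤ 1 := by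
  have hp1' : 1 ≤ ENNReal.ofReal p := by simpa using ENNReal.ofReal_le_ofReal hp1
  have hi : ∀ k, Integrable (X k) P := fun k => (hL k).integrable hp1'
  have hSL : MemLp (fun ω => ∑ k ∈ s, X k ω) (ENNReal.ofReal p) P :=
    memLp_finsetSum s fun k _ => hL k
  have hN0 := lpNormReal_nonneg (P := P) p (fun ω => ∑ k ∈ s, X k ω)
  have hone : ∫ ω, |∑ k ∈ s, X k ω| ∂P ≤ 1 / 600 := by
    refine le_trans ?_ hs
    have h1 : ∫ ω, |∑ k ∈ s, X k ω| ∂P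
        = (eLpNorm (fun ω => ∑ k ∈ s, X k ω) 1 P).toReal := by
      rw [eLpNorm_one_eq_lintegral_enorm]
      exact integral_norm_eq_lintegral_enorm hSL.1
    rw [h1]
    exact ENNReal.toReal_mono hSL.2.ne (eLpNorm_le_eLpNorm_of_exponent_le hp1' hSL.1)
  have hpow : ∫ ω, |∑ k ∈ s, X k ω| ^ p ∂P ≤ 1 / 600 := by
    rw [← lpNormReal_rpow hp1 hSL]
    rcases hN0.eq_or_lt with h | h
    · rw [← h, Real.zero_rpow (by linarith)]; norm_num
    · have := Real.rpow_le_rpow_of_exponent_ge h (by linarith) hp1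
      rw [Real.rpow_one] at this
      linarith
  have hsq := sum_integral_min_one_sq_le hX hi h0 s (by linarith)
  have htail := sum_integral_powTail_le hp1 hp2 hX hL h0 s (by linarith) (by linarith)
  have hle : ∑ k ∈ s, ∫ ω, quadPow p (X k ω) ∂P ≤
      ∑ k ∈ s, (∫ ω, min 1 (X k ω ^ 2) ∂P + ∫ ω, powTail p (X k ω) ∂P) := by
    refine Finset.sum_le_sum fun k _ => ?_
    rw [← integral_add (integrable_min_one_sq (hi k).aemeasurable) (integrable_powTail hp1 (hL k))]
    exact integral_mono (integrable_quadPow hp1 (hL k))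
      ((integrable_min_one_sq (hi k).aemeasurable).add (integrable_powTail hp1 (hL k)))
      fun ω => quadPow_le_min_add_powTail hp2 _
  rw [Finset.sum_add_distrib] at hle
  linarith

end Lower

/-! ### The decreasing rearrangement -/

instance : IsProbabilityMeasure unitIntervalMeasure :=
  ⟨by simp [unitIntervalMeasure]⟩

lemma unitIntervalMeasure_eq_restrict_Ioc :
    unitIntervalMeasure = volume.restrict (Ioc (0 : ℝ) 1) :=
  Measure.restrict_congr_set Ioo_ae_eq_Ioc

section Rearrangement

variable {α : Type*} [MeasurableSpace α] {ν : Measure α} [IsFiniteMeasure ν] {f : α → ℝ}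

lemma decrRearrangement_nonneg (ν : Measure α) (f : α → ℝ) (s : ℝ) :
    0 ≤ decrRearrangement ν f s :=
  Real.sInf_nonneg fun _ ht => ht.1

/-- The rearrangement is the generalized inverse of the distribution function. The restriction to
`0 < s` matters: for unbounded `f` the infimum defining the rearrangement at `0` is over the empty
set. -/
lemma lt_decrRearrangement_iff (hf : AEMeasurable f ν) {s τ : ℝ} (hs : 0 < s) (hτ : 0 ≤ τ) :
    τ < decrRearrangement ν f s ↔ ENNReal.ofReal s < distributionFn ν f τ := by
  constructor
  · intro h
    by_contra! hle
    refine absurd (csInf_le (s := {t : ℝ | 0 ≤ t ∧ distributionFn ν f t ≤ ENNReal.ofReal s})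
      ⟨0, fun t ht => ht.1⟩ ⟨hτ, hle⟩) (not_le.2 h)
  · intro h
    have hU : {u | τ < |f u|} = ⋃ n : ℕ, {u | τ + 1 / ((n : ℝ) + 1) < |f u|} := by
      ext u
      simp only [mem_ofPred_eq, mem_iUnion]
      constructor
      · intro hu
        obtain ⟨n, hn⟩ := exists_nat_one_div_lt (sub_pos.2 hu)
        exact ⟨n, by linarith⟩
      · rintro ⟨n, hn⟩
        have : (0 : ℝ) < 1 / ((n : ℝ) + 1) := by positivity
        linarith
    have hmono : Monotone fun n : ℕ => {u | τ + 1 / ((n : ℝ) + 1) < |f u|} := by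
      intro m n hmn u hu
      simp only [mem_ofPred_eq] at hu ⊢
      exact lt_of_le_of_lt (by gcongr) hu
    rw [distributionFn, hU, hmono.measure_iUnion, lt_iSup_iff] at h
    obtain ⟨n, hn⟩ := h
    have hpos : (0 : ℝ) < 1 / ((n : ℝ) + 1) := by positivity
    have hne : {t : ℝ | 0 ≤ t ∧ distributionFn ν f t ≤ ENNReal.ofReal s}.Nonempty := by
      have hI : ⋂ n : ℕ, {u | (n : ℝ) < |f u|} = ∅ := by
        ext u
        simp only [mem_iInter, mem_ofPred_eq, mem_empty_iff_false, iff_false, not_forall, not_lt]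
        exact exists_nat_ge _
      have htend := tendsto_measure_iInter_atTop (μ := ν) (s := fun n : ℕ => {u | (n : ℝ) < |f u|})
        (fun n => nullMeasurableSet_lt aemeasurable_const hf.abs)
        (fun m n hmn u hu => by
          simp only [mem_ofPred_eq] at hu ⊢
          exact lt_of_le_of_lt (Nat.cast_le.2 hmn) hu) ⟨0, measure_ne_top _ _⟩
      rw [hI, measure_empty] at htend
      obtain ⟨m, hm⟩ := (htend.eventually_lt_const (ENNReal.ofReal_pos.2 hs)).exists
      exact ⟨m, Nat.cast_nonneg m, hm.le⟩
    refine lt_of_lt_of_le (lt_add_of_pos_right τ hpos) (le_csInf hne fun t ht => ?_)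
    by_contra! hlt
    refine absurd (hn.trans_le ?_) (not_lt.2 ht.2)
    exact measure_mono fun u hu => lt_trans hlt hu

lemma antitoneOn_decrRearrangement (hf : AEMeasurable f ν) :
    AntitoneOn (decrRearrangement ν f) (Ioi 0) := by
  intro s hs s' hs' hss
  by_contra! hlt
  have h0 := decrRearrangement_nonneg ν f s
  have h1 := (lt_decrRearrangement_iff hf hs' h0).1 hlt
  exact lt_irrefl _ ((lt_decrRearrangement_iff hf hs h0).2
    (lt_of_le_of_lt (ENNReal.ofReal_le_ofReal hss) h1))

end Rearrangement

section UnitInterval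

variable {f : ℝ → ℝ} {p : ℝ}

local notation "ν" => unitIntervalMeasure

/-- A function on the unit interval and its rearrangement have the same distribution. -/
lemma identDistrib_decrRearrangement (hf : AEMeasurable f ν) :
    IdentDistrib (decrRearrangement ν f) (fun u => |f u|) ν ν := by
  have hg : AEMeasurable (decrRearrangement ν f) ν :=
    aemeasurable_restrict_of_antitoneOn measurableSet_Ioo
      ((antitoneOn_decrRearrangement hf).mono fun s hs => hs.1)
  refine ⟨hg, hf.abs, ?_⟩
  have : IsProbabilityMeasure (Measure.map (decrRearrangement ν f) ν) :=
    Measure.isProbabilityMeasure_map hg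
  have : IsProbabilityMeasure (Measure.map (fun u => |f u|) ν) :=
    Measure.isProbabilityMeasure_map hf.abs
  refine Measure.ext_of_Iic _ _ fun τ => ?_
  suffices h : Measure.map (decrRearrangement ν f) ν (Ioi τ) =
      Measure.map (fun u => |f u|) ν (Ioi τ) by
    rw [← compl_Ioi, prob_compl_eq_one_sub measurableSet_Ioi,
      prob_compl_eq_one_sub measurableSet_Ioi, h]
  rw [Measure.map_apply_of_aemeasurable hg measurableSet_Ioi,
    Measure.map_apply_of_aemeasurable hf.abs measurableSet_Ioi]
  rcases lt_or_ge τ 0 with hτ | hτ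
  · have h1 : decrRearrangement ν f ⁻¹' Ioi τ = univ :=
      eq_univ_of_forall fun s => hτ.trans_le (decrRearrangement_nonneg _ _ _)
    have h2 : (fun u => |f u|) ⁻¹' Ioi τ = univ :=
      eq_univ_of_forall fun s => hτ.trans_le (abs_nonneg _)
    rw [h1, h2]
  · change _ = distributionFn ν f τ
    set D := distributionFn ν f τ with hD
    have hD1 : D ≤ 1 := prob_le_one
    have hDtop : D ≠ ⊤ := ne_top_of_le_ne_top ENNReal.one_ne_top hD1
    have hset : decrRearrangement ν f ⁻¹' Ioi τ ∩ Ioo 0 1 = Ioo 0 D.toReal := by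
      ext s
      simp only [mem_inter_iff, mem_preimage, mem_Ioi, mem_Ioo]
      constructor
      · rintro ⟨h, hs0, hs1⟩
        exact ⟨hs0, (ENNReal.ofReal_lt_iff_lt_toReal hs0.le hDtop).1
          ((lt_decrRearrangement_iff hf hs0 hτ).1 h)⟩
      · rintro ⟨hs0, hsD⟩
        refine ⟨(lt_decrRearrangement_iff hf hs0 hτ).2
          ((ENNReal.ofReal_lt_iff_lt_toReal hs0.le hDtop).2 hsD), hs0, hsD.trans_le ?_⟩
        simpa using ENNReal.toReal_mono ENNReal.one_ne_top hD1
    rw [unitIntervalMeasure, Measure.restrict_apply' measurableSet_Ioo]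
    rw [← unitIntervalMeasure, hset, Real.volume_Ioo, sub_zero, ENNReal.ofReal_toReal hDtop]

/-- The modular `E min ((u f)², |u f|ᵖ)`. -/
def quadPowModular (p : ℝ) (f : ℝ → ℝ) (u : ℝ) : ℝ := ∫ s, quadPow p (u * f s) ∂ν

lemma quadPowModular_nonneg (p : ℝ) (f : ℝ → ℝ) (u : ℝ) : 0 ≤ quadPowModular p f u :=
  integral_nonneg fun _ => quadPow_nonneg _ _

lemma quadPowModular_abs (p : ℝ) (f : ℝ → ℝ) (u : ℝ) :
    quadPowModular p f |u| = quadPowModular p f u := by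
  unfold quadPowModular
  congr 1; funext s
  rw [← quadPow_abs, ← quadPow_abs p (u * f s), abs_mul, abs_abs, abs_mul]

lemma quadPowModular_mul_le (hp1 : 1 ≤ p) (hf : MemLp f (ENNReal.ofReal p) ν) {c : ℝ}
    (hc0 : 0 ≤ c) (hc1 : c ≤ 1) (u : ℝ) :
    quadPowModular p f (c * u) ≤ c * quadPowModular p f u := by
  unfold quadPowModular
  rw [← integral_const_mul]
  refine integral_mono (integrable_quadPow hp1 (hf.const_mul _))
    ((integrable_quadPow hp1 (hf.const_mul _)).const_mul c) fun s => ?_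
  simp only [mul_assoc c u]
  exact quadPow_mul_le_mul hp1 hc0 hc1 _

/-- The sum of the `p`-average of `f*` over `(0, t)` and of the normalized `L₂` norm of `f*` over
`(t, 1)`. -/
def rearrangementMean (p : ℝ) (f : ℝ → ℝ) (t : ℝ) : ℝ :=
  ((1 / t) * ∫ s in (0 : ℝ)..t, decrRearrangement ν f s ^ p) ^ (1 / p) +
    ((1 / t) * ∫ s in t..(1 : ℝ), decrRearrangement ν f s ^ (2 : ℝ)) ^ (1 / 2 : ℝ)

lemma memLp_decrRearrangement (hf : MemLp f (ENNReal.ofReal p) ν) :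
    MemLp (decrRearrangement ν f) (ENNReal.ofReal p) ν :=
  (identDistrib_decrRearrangement hf.1.aemeasurable).symm.memLp_snd hf.abs

lemma intervalIntegrable_quadPow_mul_decrRearrangement (hp1 : 1 ≤ p)
    (hf : MemLp f (ENNReal.ofReal p) ν) (u : ℝ) :
    IntervalIntegrable (fun s => quadPow p (u * decrRearrangement ν f s)) volume 0 1 := by
  rw [intervalIntegrable_iff_integrableOn_Ioc_of_le zero_le_one, IntegrableOn,
    ← unitIntervalMeasure_eq_restrict_Ioc]
  exact integrable_quadPow hp1 ((memLp_decrRearrangement hf).const_mul u)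

lemma quadPowModular_eq_integral_decrRearrangement (hp1 : 1 ≤ p)
    (hf : MemLp f (ENNReal.ofReal p) ν) (u : ℝ) :
    quadPowModular p f u = ∫ s in (0 : ℝ)..1, quadPow p (u * decrRearrangement ν f s) := by
  rw [intervalIntegral.integral_of_le zero_le_one, ← unitIntervalMeasure_eq_restrict_Ioc]
  have h := ((identDistrib_decrRearrangement hf.1.aemeasurable).comp
    (u := fun x => quadPow p (u * x))
    ((continuous_quadPow hp1).comp (continuous_const_mul u)).measurable).integral_eq
  simp only [Function.comp_def] at h
  rw [h, quadPowModular]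
  congr 1; funext s
  rw [← quadPow_abs, ← quadPow_abs p (u * |f s|), abs_mul, abs_mul, abs_abs]

lemma intervalIntegrable_decrRearrangement_rpow (hp1 : 1 ≤ p)
    (hf : MemLp f (ENNReal.ofReal p) ν) :
    IntervalIntegrable (fun s => decrRearrangement ν f s ^ p) volume 0 1 := by
  rw [intervalIntegrable_iff_integrableOn_Ioc_of_le zero_le_one, IntegrableOn,
    ← unitIntervalMeasure_eq_restrict_Ioc]
  have h := (memLp_decrRearrangement hf).integrable_norm_rpow (by simp; linarith)
    ENNReal.ofReal_ne_top
  rw [ENNReal.toReal_ofReal (by linarith)] at h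
  simpa only [Real.norm_of_nonneg (decrRearrangement_nonneg _ _ _)] using h

lemma intervalIntegrable_decrRearrangement_sq (hf : AEMeasurable f ν) {t : ℝ} (ht : 0 < t) :
    IntervalIntegrable (fun s => decrRearrangement ν f s ^ (2 : ℝ)) volume t 1 := by
  refine AntitoneOn.intervalIntegrable fun a ha b hb hab => ?_
  have hpos : ∀ c ∈ uIcc t 1, 0 < c := fun c hc => (lt_min ht one_pos).trans_le hc.1
  exact Real.rpow_le_rpow (decrRearrangement_nonneg _ _ _)
    (antitoneOn_decrRearrangement hf (hpos a ha) (hpos b hb) hab) (by norm_num)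

lemma uIcc_subset_uIcc_zero_left {t : ℝ} (ht0 : 0 ≤ t) (ht1 : t ≤ 1) :
    uIcc 0 t ⊆ uIcc (0 : ℝ) 1 :=
  uIcc_subset_uIcc_left (by rw [uIcc_of_le zero_le_one]; exact ⟨ht0, ht1⟩)

lemma uIcc_subset_uIcc_one_right {t : ℝ} (ht0 : 0 ≤ t) (ht1 : t ≤ 1) :
    uIcc t 1 ⊆ uIcc (0 : ℝ) 1 :=
  uIcc_subset_uIcc_right (by rw [uIcc_of_le zero_le_one]; exact ⟨ht0, ht1⟩)

/-- If the modular at `1 / ρ` is at most `t`, then `f* ≤ ρ` to the right of `t`, where the modular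
is quadratic. -/
lemma decrRearrangement_le_of_quadPowModular_le (hp1 : 1 ≤ p)
    (hf : MemLp f (ENNReal.ofReal p) ν) {t ρ : ℝ} (ht0 : 0 < t) (ht1 : t ≤ 1) (hρ : 0 < ρ)
    (h : quadPowModular p f ρ⁻¹ ≤ t) : decrRearrangement ν f t ≤ ρ := by
  by_contra! hlt
  set g := decrRearrangement ν f with hg
  have hgt : 1 < ρ⁻¹ * g t := by
    rw [inv_mul_eq_div, one_lt_div hρ]; exact hlt
  have hq : 1 < quadPow p (ρ⁻¹ * g t) := by
    rw [quadPow, abs_of_pos (by linarith)]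
    exact lt_min (one_lt_pow₀ hgt two_ne_zero) (Real.one_lt_rpow hgt (by linarith))
  have hint := intervalIntegrable_quadPow_mul_decrRearrangement hp1 hf ρ⁻¹
  have hint1 := hint.mono_set (uIcc_subset_uIcc_zero_left ht0.le ht1)
  have hint2 := hint.mono_set (uIcc_subset_uIcc_one_right ht0.le ht1)
  have h1 : t * quadPow p (ρ⁻¹ * g t) ≤ ∫ s in (0 : ℝ)..t, quadPow p (ρ⁻¹ * g s) := by
    calc t * quadPow p (ρ⁻¹ * g t) = ∫ _ in (0 : ℝ)..t, quadPow p (ρ⁻¹ * g t) := by simp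
      _ ≤ _ := by
        refine intervalIntegral.integral_mono_on_of_le_Ioo ht0.le (by simp) hint1 fun s hs => ?_
        refine quadPow_mono hp1 ?_
        rw [abs_mul, abs_mul]
        refine mul_le_mul_of_nonneg_left ?_ (abs_nonneg _)
        rw [abs_of_nonneg (decrRearrangement_nonneg _ _ _),
          abs_of_nonneg (decrRearrangement_nonneg _ _ _)]
        exact antitoneOn_decrRearrangement hf.1.aemeasurable hs.1 ht0 hs.2.le
  have h2 : 0 ≤ ∫ s in t..(1 : ℝ), quadPow p (ρ⁻¹ * g s) :=
    intervalIntegral.integral_nonneg ht1 fun _ _ => quadPow_nonneg _ _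
  rw [quadPowModular_eq_integral_decrRearrangement hp1 hf,
    ← intervalIntegral.integral_add_adjacent_intervals hint1 hint2] at h
  nlinarith

/-- Together with `quadPowModular_le_of_rearrangementMean_le`: the rearrangement mean at `t` is, up
to constants, the number `ρ` at which the modular of `f / ρ` equals `t`. -/
lemma rearrangementMean_le_of_quadPowModular_le (hp1 : 1 ≤ p) (hp2 : p ≤ 2)
    (hf : MemLp f (ENNReal.ofReal p) ν) {t ρ : ℝ} (ht0 : 0 < t) (ht1 : t ≤ 1) (hρ : 0 < ρ)
    (h : quadPowModular p f ρ⁻¹ ≤ t) : rearrangementMean p f t ≤ 3 * ρ := by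
  have hgt := decrRearrangement_le_of_quadPowModular_le hp1 hf ht0 ht1 hρ h
  have hp0 : 0 < p := by linarith
  have hint := intervalIntegrable_quadPow_mul_decrRearrangement hp1 hf ρ⁻¹
  have hint1 := hint.mono_set (uIcc_subset_uIcc_zero_left ht0.le ht1)
  have hint2 := hint.mono_set (uIcc_subset_uIcc_one_right ht0.le ht1)
  have hintp := (intervalIntegrable_decrRearrangement_rpow hp1 hf).mono_set
    (uIcc_subset_uIcc_zero_left ht0.le ht1)
  have hints := intervalIntegrable_decrRearrangement_sq hf.1.aemeasurable ht0
  rw [quadPowModular_eq_integral_decrRearrangement hp1 hf,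
    ← intervalIntegral.integral_add_adjacent_intervals hint1 hint2] at h
  have hn1 : 0 ≤ ∫ s in (0 : ℝ)..t, quadPow p (ρ⁻¹ * decrRearrangement ν f s) :=
    intervalIntegral.integral_nonneg ht0.le fun _ _ => quadPow_nonneg _ _
  have hn2 : 0 ≤ ∫ s in t..(1 : ℝ), quadPow p (ρ⁻¹ * decrRearrangement ν f s) :=
    intervalIntegral.integral_nonneg ht1 fun _ _ => quadPow_nonneg _ _
  have hA0 : 0 ≤ ∫ s in (0 : ℝ)..t, decrRearrangement ν f s ^ p :=
    intervalIntegral.integral_nonneg ht0.le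
      fun _ _ => Real.rpow_nonneg (decrRearrangement_nonneg _ _ _) _
  have hB0 : 0 ≤ ∫ s in t..(1 : ℝ), decrRearrangement ν f s ^ (2 : ℝ) :=
    intervalIntegral.integral_nonneg ht1
      fun _ _ => Real.rpow_nonneg (decrRearrangement_nonneg _ _ _) _
  have hA : ∫ s in (0 : ℝ)..t, decrRearrangement ν f s ^ p ≤ t * (2 * ρ) ^ p := by
    calc ∫ s in (0 : ℝ)..t, decrRearrangement ν f s ^ p
        ≤ ∫ s in (0 : ℝ)..t, ρ ^ p * (1 + quadPow p (ρ⁻¹ * decrRearrangement ν f s)) := by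
          refine intervalIntegral.integral_mono_on ht0.le hintp
            (((by simp : IntervalIntegrable (fun _ => (1 : ℝ)) volume 0 t).add hint1).const_mul _)
            fun s _ => ?_
          have hg0 := decrRearrangement_nonneg ν f s
          have := rpow_le_one_add_quadPow hp1 hp2 (ρ⁻¹ * decrRearrangement ν f s)
          calc decrRearrangement ν f s ^ p
              = ρ ^ p * |ρ⁻¹ * decrRearrangement ν f s| ^ p := by
                rw [abs_of_nonneg (by positivity), ← Real.mul_rpow hρ.le (by positivity),
                  mul_inv_cancel_left₀ hρ.ne']
            _ ≤ _ := by gcongr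
      _ = ρ ^ p * (t + ∫ s in (0 : ℝ)..t, quadPow p (ρ⁻¹ * decrRearrangement ν f s)) := by
          rw [intervalIntegral.integral_const_mul, intervalIntegral.integral_add (by simp) hint1]
          simp
      _ ≤ ρ ^ p * (t + t) := by gcongr; linarith
      _ = t * (2 * ρ ^ p) := by ring
      _ ≤ t * (2 * ρ) ^ p := by
          rw [Real.mul_rpow (by norm_num) hρ.le]
          gcongr
          simpa using Real.rpow_le_rpow_of_exponent_le (one_le_two (α := ℝ)) hp1
  have hB : ∫ s in t..(1 : ℝ), decrRearrangement ν f s ^ (2 : ℝ) ≤ t * ρ ^ (2 : ℝ) := by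
    calc ∫ s in t..(1 : ℝ), decrRearrangement ν f s ^ (2 : ℝ)
        ≤ ∫ s in t..(1 : ℝ), ρ ^ (2 : ℝ) * quadPow p (ρ⁻¹ * decrRearrangement ν f s) := by
          refine intervalIntegral.integral_mono_on ht1 hints (hint2.const_mul _)
            fun s hs => le_of_eq ?_
          have hg0 := decrRearrangement_nonneg ν f s
          have hle : decrRearrangement ν f s ≤ ρ :=
            (antitoneOn_decrRearrangement hf.1.aemeasurable ht0 (ht0.trans_le hs.1) hs.1).trans hgt
          rw [quadPow_of_abs_le_one hp2, Real.rpow_two, Real.rpow_two, ← mul_pow,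
            mul_inv_cancel_left₀ hρ.ne']
          rw [abs_of_nonneg (by positivity), inv_mul_eq_div]
          exact div_le_one_of_le₀ hle hρ.le
      _ = ρ ^ (2 : ℝ) * ∫ s in t..(1 : ℝ), quadPow p (ρ⁻¹ * decrRearrangement ν f s) :=
          intervalIntegral.integral_const_mul _ _
      _ ≤ ρ ^ (2 : ℝ) * t := by gcongr; linarith
      _ = _ := mul_comm _ _
  have h1 : ((1 / t) * ∫ s in (0 : ℝ)..t, decrRearrangement ν f s ^ p) ^ (1 / p) ≤ 2 * ρ := by
    rw [one_div p, Real.rpow_inv_le_iff_of_pos (by positivity) (by positivity) hp0]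
    rw [one_div, inv_mul_le_iff₀ ht0]
    exact hA
  have h2 : ((1 / t) * ∫ s in t..(1 : ℝ), decrRearrangement ν f s ^ (2 : ℝ)) ^ (1 / 2 : ℝ)
      ≤ ρ := by
    rw [one_div (2 : ℝ), Real.rpow_inv_le_iff_of_pos (by positivity) hρ.le two_pos]
    rw [one_div, inv_mul_le_iff₀ ht0]
    exact hB
  unfold rearrangementMean
  linarith

lemma quadPowModular_le_of_rearrangementMean_le (hp1 : 1 ≤ p)
    (hf : MemLp f (ENNReal.ofReal p) ν) {t ρ : ℝ} (ht0 : 0 < t) (ht1 : t ≤ 1) (hρ : 0 < ρ)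
    (h : rearrangementMean p f t ≤ ρ) : quadPowModular p f ρ⁻¹ ≤ 2 * t := by
  have hp0 : 0 < p := by linarith
  have hint := intervalIntegrable_quadPow_mul_decrRearrangement hp1 hf ρ⁻¹
  have hint1 := hint.mono_set (uIcc_subset_uIcc_zero_left ht0.le ht1)
  have hint2 := hint.mono_set (uIcc_subset_uIcc_one_right ht0.le ht1)
  have hintp := (intervalIntegrable_decrRearrangement_rpow hp1 hf).mono_set
    (uIcc_subset_uIcc_zero_left ht0.le ht1)
  have hints := intervalIntegrable_decrRearrangement_sq hf.1.aemeasurable ht0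
  have hA0 : 0 ≤ ∫ s in (0 : ℝ)..t, decrRearrangement ν f s ^ p :=
    intervalIntegral.integral_nonneg ht0.le
      fun _ _ => Real.rpow_nonneg (decrRearrangement_nonneg _ _ _) _
  have hB0 : 0 ≤ ∫ s in t..(1 : ℝ), decrRearrangement ν f s ^ (2 : ℝ) :=
    intervalIntegral.integral_nonneg ht1
      fun _ _ => Real.rpow_nonneg (decrRearrangement_nonneg _ _ _) _
  have h1' : 0 ≤ ((1 / t) * ∫ s in (0 : ℝ)..t, decrRearrangement ν f s ^ p) ^ (1 / p) := by
    positivity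
  have h2' : 0 ≤ ((1 / t) * ∫ s in t..(1 : ℝ), decrRearrangement ν f s ^ (2 : ℝ)) ^ (1 / 2 : ℝ) := by
    positivity
  unfold rearrangementMean at h
  have hA : ((1 / t) * ∫ s in (0 : ℝ)..t, decrRearrangement ν f s ^ p) ^ (1 / p) ≤ ρ := by
    linarith
  have hB : ((1 / t) * ∫ s in t..(1 : ℝ), decrRearrangement ν f s ^ (2 : ℝ)) ^ (1 / 2 : ℝ)
      ≤ ρ := by linarith
  rw [one_div p, Real.rpow_inv_le_iff_of_pos (by positivity) hρ.le hp0, one_div,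
    inv_mul_le_iff₀ ht0] at hA
  rw [one_div (2 : ℝ), Real.rpow_inv_le_iff_of_pos (by positivity) hρ.le two_pos, one_div,
    inv_mul_le_iff₀ ht0] at hB
  rw [quadPowModular_eq_integral_decrRearrangement hp1 hf,
    ← intervalIntegral.integral_add_adjacent_intervals hint1 hint2]
  have hρp : 0 < ρ ^ p := Real.rpow_pos_of_pos hρ p
  have hρ2 : 0 < ρ ^ (2 : ℝ) := Real.rpow_pos_of_pos hρ 2
  have hA' : ∫ s in (0 : ℝ)..t, quadPow p (ρ⁻¹ * decrRearrangement ν f s) ≤ t := by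
    calc _ ≤ ∫ s in (0 : ℝ)..t, (ρ ^ p)⁻¹ * decrRearrangement ν f s ^ p := by
          refine intervalIntegral.integral_mono_on ht0.le hint1 (hintp.const_mul _) fun s _ => ?_
          have hg0 := decrRearrangement_nonneg ν f s
          refine (quadPow_le_rpow _ _).trans (le_of_eq ?_)
          rw [abs_of_nonneg (by positivity), Real.mul_rpow (by positivity) hg0,
            Real.inv_rpow hρ.le]
      _ ≤ t := by
          rw [intervalIntegral.integral_const_mul, inv_mul_le_iff₀ hρp, mul_comm]
          exact hA
  have hB' : ∫ s in t..(1 : ℝ), quadPow p (ρ⁻¹ * decrRearrangement ν f s) ≤ t := by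
    calc _ ≤ ∫ s in t..(1 : ℝ), (ρ ^ (2 : ℝ))⁻¹ * decrRearrangement ν f s ^ (2 : ℝ) := by
          refine intervalIntegral.integral_mono_on ht1 hint2 (hints.const_mul _) fun s _ => ?_
          refine (quadPow_le_sq _ _).trans (le_of_eq ?_)
          rw [Real.rpow_two, Real.rpow_two, mul_pow, inv_pow]
      _ ≤ t := by
          rw [intervalIntegral.integral_const_mul, inv_mul_le_iff₀ hρ2, mul_comm]
          exact hB
  linarith

end UnitInterval

/-! ### Orlicz functions and Orlicz sequence norms -/

section Orlicz

variable {M : ℝ → ℝ}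

lemma IsOrliczFunction.nonneg (hM : IsOrliczFunction M) {x : ℝ} (hx : 0 ≤ x) : 0 ≤ M x :=
  hM.bijOn.mapsTo hx

lemma IsOrliczFunction.strictMonoOn (hM : IsOrliczFunction M) : StrictMonoOn M (Ici 0) :=
  hM.monotoneOn.strictMonoOn_of_injOn hM.bijOn.injOn

lemma IsOrliczFunction.map_mul_le (hM : IsOrliczFunction M) {c x : ℝ} (hc0 : 0 ≤ c) (hc1 : c ≤ 1)
    (hx : 0 ≤ x) : M (c * x) ≤ c * M x := by
  have h := hM.convexOn.2 (x := x) (y := 0) hx self_mem_Ici hc0 (sub_nonneg.2 hc1) (by ring)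
  simpa [hM.map_zero] using h

lemma IsOrliczFunction.orliczInverse_nonneg (hM : IsOrliczFunction M) {t : ℝ} (ht : 0 ≤ t) :
    0 ≤ orliczInverse M t :=
  Function.invFunOn_mem (hM.bijOn.surjOn ht)

lemma IsOrliczFunction.map_orliczInverse (hM : IsOrliczFunction M) {t : ℝ} (ht : 0 ≤ t) :
    M (orliczInverse M t) = t :=
  Function.invFunOn_eq (hM.bijOn.surjOn ht)

lemma IsOrliczFunction.orliczInverse_map (hM : IsOrliczFunction M) {x : ℝ} (hx : 0 ≤ x) :
    orliczInverse M (M x) = x :=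
  hM.bijOn.injOn (hM.orliczInverse_nonneg (hM.nonneg hx)) hx (hM.map_orliczInverse (hM.nonneg hx))

lemma IsOrliczFunction.orliczInverse_pos (hM : IsOrliczFunction M) {t : ℝ} (ht : 0 < t) :
    0 < orliczInverse M t := by
  refine (hM.orliczInverse_nonneg ht.le).lt_of_ne fun h => ?_
  have := hM.map_orliczInverse ht.le
  rw [← h, hM.map_zero] at this
  exact ht.ne this

lemma IsOrliczFunction.tsum_indicator_le_one_iff (hM : IsOrliczFunction M) (s : Finset ℕ)
    (b : ℕ → ℝ) {r : ℝ} (hr : 0 < r) :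
    ∑' n, ENNReal.ofReal (M (|(s : Set ℕ).indicator b n| / r)) ≤ 1 ↔
      ∑ n ∈ s, M (|b n| / r) ≤ 1 := by
  rw [tsum_eq_sum (s := s) fun n hn => by
    rw [indicator_of_notMem (by simpa using hn)]; simp [hM.map_zero]]
  rw [← ENNReal.ofReal_one, ← ENNReal.ofReal_sum_of_nonneg fun n _ => hM.nonneg (by positivity),
    ENNReal.ofReal_le_ofReal_iff zero_le_one]
  rw [Finset.sum_congr rfl fun n hn => by rw [indicator_of_mem (by simpa using hn)]]

lemma orliczSeqNorm_nonneg (M : ℝ → ℝ) (a : ℕ → ℝ) : 0 ≤ orliczSeqNorm M a :=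
  Real.sInf_nonneg fun _ h => h.1.le

lemma IsOrliczFunction.orliczSeqNorm_indicator_le (hM : IsOrliczFunction M) {s : Finset ℕ}
    {b : ℕ → ℝ} {r : ℝ} (hr : 0 < r) (h : ∑ n ∈ s, M (|b n| / r) ≤ 1) :
    orliczSeqNorm M ((s : Set ℕ).indicator b) ≤ r :=
  csInf_le ⟨0, fun _ h => h.1.le⟩ ⟨hr, (hM.tsum_indicator_le_one_iff s b hr).2 h⟩

lemma IsOrliczFunction.sum_le_one_of_orliczSeqNorm_lt (hM : IsOrliczFunction M) {s : Finset ℕ}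
    {b : ℕ → ℝ} {r : ℝ} (h : orliczSeqNorm M ((s : Set ℕ).indicator b) < r) :
    ∑ n ∈ s, M (|b n| / r) ≤ 1 := by
  have hne : {ρ : ℝ | 0 < ρ ∧
      ∑' n, ENNReal.ofReal (M (|(s : Set ℕ).indicator b n| / ρ)) ≤ 1}.Nonempty := by
    -- Since `M x ≤ x` on `[0, 1]`, any `ρ` exceeding the `ℓ₁` norm is admissible.
    have h0 : 0 ≤ ∑ n ∈ s, |b n| := Finset.sum_nonneg fun n _ => abs_nonneg _
    have hρ : 0 < 1 + ∑ n ∈ s, |b n| := by linarith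
    refine ⟨1 + ∑ n ∈ s, |b n|, hρ, (hM.tsum_indicator_le_one_iff s b hρ).2 ?_⟩
    calc ∑ n ∈ s, M (|b n| / (1 + ∑ n ∈ s, |b n|))
        ≤ ∑ n ∈ s, |b n| / (1 + ∑ n ∈ s, |b n|) := by
          refine Finset.sum_le_sum fun n hn => ?_
          have h1 : |b n| ≤ ∑ n ∈ s, |b n| :=
            Finset.single_le_sum (f := fun n => |b n|) (fun _ _ => abs_nonneg _) hn
          have := hM.map_mul_le (c := |b n| / (1 + ∑ n ∈ s, |b n|)) (x := 1) (by positivity)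
            (div_le_one_of_le₀ (by linarith) hρ.le) zero_le_one
          simpa [hM.map_one] using this
      _ ≤ 1 := by
          rw [← Finset.sum_div]
          exact div_le_one_of_le₀ (by linarith) hρ.le
  obtain ⟨ρ, ⟨hρ0, hρ⟩, hρr⟩ := exists_lt_of_csInf_lt hne h
  refine le_trans (Finset.sum_le_sum fun n _ => ?_) ((hM.tsum_indicator_le_one_iff s b hρ0).1 hρ)
  have hr : 0 < r := hρ0.trans hρr
  refine hM.monotoneOn (mem_Ici.2 (by positivity)) (mem_Ici.2 (by positivity)) ?_
  gcongr

end Orlicz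

/-! ### Independent copies -/

section Copies

variable {p : ℝ} {f : ℝ → ℝ} {Ω : Type*} [MeasurableSpace Ω] {P : Measure Ω}
  {X : ℕ → Ω → ℝ}

lemma IsIndependentCopies.iIndepFun_const_mul (hX : IsIndependentCopies X P f unitIntervalMeasure)
    (b : ℕ → ℝ) : iIndepFun (fun k ω => b k * X k ω) P :=
  hX.indep.comp (fun k x => b k * x) fun k => measurable_const_mul (b k)

lemma IsIndependentCopies.memLp_const_mul (hX : IsIndependentCopies X P f unitIntervalMeasure)
    (hf : MemLp f (ENNReal.ofReal p) unitIntervalMeasure) (b : ℕ → ℝ) (k : ℕ) :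
    MemLp (fun ω => b k * X k ω) (ENNReal.ofReal p) P :=
  ((hX.identDistrib k).memLp_iff.2 hf).const_mul (b k)

lemma IsIndependentCopies.integral_const_mul_eq_zero
    (hX : IsIndependentCopies X P f unitIntervalMeasure)
    (hmean : ∫ u, f u ∂unitIntervalMeasure = 0) (b : ℕ → ℝ) (k : ℕ) :
    ∫ ω, b k * X k ω ∂P = 0 := by
  rw [integral_const_mul, (hX.identDistrib k).integral_eq, hmean, mul_zero]

lemma IsIndependentCopies.integral_quadPow (hX : IsIndependentCopies X P f unitIntervalMeasure)
    (hp1 : 1 ≤ p) (u : ℝ) (k : ℕ) :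
    ∫ ω, quadPow p (u * X k ω) ∂P = quadPowModular p f u :=
  ((hX.identDistrib k).comp (u := fun x => quadPow p (u * x))
    ((continuous_quadPow hp1).comp (continuous_const_mul u)).measurable).integral_eq

/-- The equivalence of the two sequences, with finitely supported sequences written as functions
restricted to finite sets. -/
lemma sequencesEquivalent_iff (M : ℝ → ℝ) :
    SequencesEquivalent (lpNormReal P p) X
        (orliczSeqNorm M) (fun n : ℕ => (Pi.single n (1 : ℝ) : ℕ → ℝ)) ↔
      ∃ C : ℝ, 0 < C ∧ ∀ (s : Finset ℕ) (b : ℕ → ℝ),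
        C⁻¹ * lpNormReal P p (fun ω => ∑ k ∈ s, b k * X k ω) ≤
            orliczSeqNorm M ((s : Set ℕ).indicator b) ∧
          orliczSeqNorm M ((s : Set ℕ).indicator b) ≤
            C * lpNormReal P p (fun ω => ∑ k ∈ s, b k * X k ω) := by
  have hX : ∀ a : ℕ →₀ ℝ, (a.sum fun n c => c • X n) = fun ω => ∑ k ∈ a.support, a k * X k ω :=
    fun a => by funext ω; simp [Finsupp.sum, Finset.sum_apply]
  have he : ∀ a : ℕ →₀ ℝ, (a.sum fun n c => c • (Pi.single n (1 : ℝ) : ℕ → ℝ))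
      = (a.support : Set ℕ).indicator a := fun a => by
    funext n
    simp only [Finsupp.sum, Finset.sum_apply, Pi.smul_apply, smul_eq_mul, Pi.single_apply,
      mul_ite, mul_one, mul_zero, Finset.sum_ite_eq, indicator, Finset.mem_coe]
  unfold SequencesEquivalent EquivalentOn
  simp only [hX, he, mem_univ, forall_true_left]
  refine exists_congr fun C => and_congr_right fun _ => ⟨fun h s b => ?_, fun h a => h _ _⟩
  have h1 := h (Finsupp.indicator s fun k _ => b k)
  set a : ℕ →₀ ℝ := Finsupp.indicator s fun k _ => b k with ha
  have hval : ∀ k, a k = (s : Set ℕ).indicator b k := fun k => by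
    by_cases hk : k ∈ s
    · rw [ha, Finsupp.indicator_of_mem hk, indicator_of_mem (by simpa using hk)]
    · rw [ha, Finsupp.indicator_of_notMem hk, indicator_of_notMem (by simpa using hk)]
  have hsum : (fun ω => ∑ k ∈ a.support, a k * X k ω) = fun ω => ∑ k ∈ s, b k * X k ω := by
    funext ω
    rw [Finset.sum_subset (Finsupp.support_indicator_subset s _) fun k _ hk => by
      rw [Finsupp.notMem_support_iff.1 hk, zero_mul]]
    refine Finset.sum_congr rfl fun k hk => ?_
    rw [hval, indicator_of_mem (by simpa using hk)]
  have hind : (a.support : Set ℕ).indicator a = (s : Set ℕ).indicator b := by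
    funext k
    rw [← hval]
    by_cases hk : k ∈ a.support
    · rw [indicator_of_mem (by simpa using hk)]
    · rw [indicator_of_notMem (by simpa using hk), Finsupp.notMem_support_iff.1 hk]
  rwa [hsum, hind] at h1

variable [IsProbabilityMeasure P]

lemma IsIndependentCopies.lpNormReal_le (hX : IsIndependentCopies X P f unitIntervalMeasure)
    (hp1 : 1 ≤ p) (hp2 : p ≤ 2) (hf : MemLp f (ENNReal.ofReal p) unitIntervalMeasure)
    (hmean : ∫ u, f u ∂unitIntervalMeasure = 0) {s : Finset ℕ} {b : ℕ → ℝ} {r : ℝ} (hr : 0 < r)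
    (h : ∑ k ∈ s, quadPowModular p f (b k / r) ≤ 1) :
    lpNormReal P p (fun ω => ∑ k ∈ s, b k * X k ω) ≤ 7 * r := by
  have h1 := lpNormReal_sum_le hp1 hp2 (hX.iIndepFun_const_mul fun k => b k / r)
    (hX.memLp_const_mul hf fun k => b k / r) (hX.integral_const_mul_eq_zero hmean fun k => b k / r)
    s (by simpa only [hX.integral_quadPow hp1] using h)
  have h2 : lpNormReal P p (fun ω => ∑ k ∈ s, b k * X k ω)
      = r * lpNormReal P p (fun ω => ∑ k ∈ s, b k / r * X k ω) := by
    rw [← abs_of_pos hr, ← lpNormReal_const_mul, abs_of_pos hr]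
    congr 1; funext ω
    rw [Finset.mul_sum]
    refine Finset.sum_congr rfl fun k _ => ?_
    field_simp
  rw [h2]
  nlinarith

lemma IsIndependentCopies.sum_quadPowModular_le_one
    (hX : IsIndependentCopies X P f unitIntervalMeasure)
    (hp1 : 1 ≤ p) (hp2 : p ≤ 2) (hf : MemLp f (ENNReal.ofReal p) unitIntervalMeasure)
    (hmean : ∫ u, f u ∂unitIntervalMeasure = 0) {s : Finset ℕ} {b : ℕ → ℝ} {r : ℝ} (hr : 0 < r)
    (h : lpNormReal P p (fun ω => ∑ k ∈ s, b k * X k ω) ≤ r) :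
    ∑ k ∈ s, quadPowModular p f (b k / (600 * r)) ≤ 1 := by
  have hr' : 0 < 600 * r := by positivity
  have h2 : lpNormReal P p (fun ω => ∑ k ∈ s, b k * X k ω)
      = 600 * r * lpNormReal P p (fun ω => ∑ k ∈ s, b k / (600 * r) * X k ω) := by
    rw [← abs_of_pos hr', ← lpNormReal_const_mul, abs_of_pos hr']
    congr 1; funext ω
    rw [Finset.mul_sum]
    refine Finset.sum_congr rfl fun k _ => ?_
    field_simp
  have h1 := sum_integral_quadPow_le_one hp1 hp2 (hX.iIndepFun_const_mul fun k => b k / (600 * r))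
    (hX.memLp_const_mul hf fun k => b k / (600 * r))
    (hX.integral_const_mul_eq_zero hmean fun k => b k / (600 * r)) s (by
      rw [h2] at h
      rw [le_div_iff₀ (by norm_num)]
      refine le_of_mul_le_mul_left ?_ hr
      linarith)
  simpa only [hX.integral_quadPow hp1] using h1

/-! ### Norm equivalence and the rearrangement condition -/

lemma rearrangementMean_nonneg (p : ℝ) (f : ℝ → ℝ) {t : ℝ} (ht0 : 0 < t) (ht1 : t ≤ 1) :
    0 ≤ rearrangementMean p f t := by
  have hA0 : 0 ≤ ∫ s in (0 : ℝ)..t, decrRearrangement unitIntervalMeasure f s ^ p :=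
    intervalIntegral.integral_nonneg ht0.le
      fun _ _ => Real.rpow_nonneg (decrRearrangement_nonneg _ _ _) _
  have hB0 : 0 ≤ ∫ s in t..(1 : ℝ), decrRearrangement unitIntervalMeasure f s ^ (2 : ℝ) :=
    intervalIntegral.integral_nonneg ht1
      fun _ _ => Real.rpow_nonneg (decrRearrangement_nonneg _ _ _) _
  unfold rearrangementMean
  positivity

lemma quadPowModular_half_le (hp1 : 1 ≤ p) (hf : MemLp f (ENNReal.ofReal p) unitIntervalMeasure)
    {u t : ℝ} (h : quadPowModular p f u ≤ 2 * t) : quadPowModular p f (u / 2) ≤ t := by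
  have := quadPowModular_mul_le hp1 hf (c := 1 / 2) (by norm_num) (by norm_num) u
  rw [show u / 2 = 1 / 2 * u by ring]
  linarith

/-- Testing the equivalence of norms on sums of `⌊1 / t⌋` basis vectors. -/
lemma IsIndependentCopies.equivalentOn_of_norm_equiv
    (hX : IsIndependentCopies X P f unitIntervalMeasure)
    (hp1 : 1 ≤ p) (hp2 : p ≤ 2) (hf : MemLp f (ENNReal.ofReal p) unitIntervalMeasure)
    (hmean : ∫ u, f u ∂unitIntervalMeasure = 0) {M : ℝ → ℝ} (hM : IsOrliczFunction M)
    {C : ℝ} (hC : 0 < C)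
    (h : ∀ (s : Finset ℕ) (b : ℕ → ℝ),
      C⁻¹ * lpNormReal P p (fun ω => ∑ k ∈ s, b k * X k ω) ≤
          orliczSeqNorm M ((s : Set ℕ).indicator b) ∧
        orliczSeqNorm M ((s : Set ℕ).indicator b) ≤
          C * lpNormReal P p (fun ω => ∑ k ∈ s, b k * X k ω)) :
    EquivalentOn (Ioc (0 : ℝ) 1) (fun t => 1 / orliczInverse M t) (rearrangementMean p f) := by
  refine ⟨3600 * C, by positivity, fun t ⟨ht0, ht1⟩ => ?_⟩
  have hv0 := hM.orliczInverse_pos ht0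
  have hMv := hM.map_orliczInverse ht0.le
  simp only
  set v := orliczInverse M t
  have hw0 : 0 < 1 / v := by positivity
  set n : ℕ := ⌊1 / t⌋₊ with hn
  have hn1 : (1 : ℝ) ≤ n := by
    rw [Nat.one_le_cast, hn, Nat.one_le_floor_iff, one_le_div ht0]; exact ht1
  have hnt : n * t ≤ 1 := by
    rw [← le_div_iff₀ ht0]; exact Nat.floor_le (by positivity)
  have hnt' : 1 ≤ 2 * (n * t) := by
    have := Nat.lt_floor_add_one (1 / t)
    rw [← hn, div_lt_iff₀ ht0] at this
    nlinarith
  have hn0 : (0 : ℝ) < n := by linarith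
  have hdiv : ∀ {z : ℝ}, n * z ≤ 1 → z ≤ 2 * t := fun {z} hz => by
    by_contra! hlt
    nlinarith [mul_lt_mul_of_pos_left hlt hn0]
  obtain ⟨hlow, hupp⟩ := h (Finset.range n) fun _ => 1
  set N := lpNormReal P p (fun ω => ∑ k ∈ Finset.range n, 1 * X k ω) with hN
  constructor
  · have key : ∀ ρ, rearrangementMean p f t < ρ → 1 / v ≤ 30 * C * ρ := by
      intro ρ hρ
      have hρ0 : 0 < ρ := (rearrangementMean_nonneg p f ht0 ht1).trans_lt hρ
      have h1 := quadPowModular_half_le hp1 hf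
        (quadPowModular_le_of_rearrangementMean_le hp1 hf ht0 ht1 hρ0 hρ.le)
      have h2 : N ≤ 7 * (2 * ρ) := by
        refine hX.lpNormReal_le hp1 hp2 hf hmean (by positivity) ?_
        rw [Finset.sum_const, Finset.card_range, nsmul_eq_mul,
          show 1 / (2 * ρ) = ρ⁻¹ / 2 by field_simp]
        nlinarith
      have h3 : orliczSeqNorm M ((Finset.range n : Set ℕ).indicator fun _ => 1) < 15 * C * ρ := by
        nlinarith [mul_pos hC hρ0]
      have h4 := hM.sum_le_one_of_orliczSeqNorm_lt h3
      rw [Finset.sum_const, Finset.card_range, nsmul_eq_mul, abs_one] at h4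
      have h5 := hM.map_mul_le (c := 1 / 2) (x := 1 / (15 * C * ρ)) (by norm_num) (by norm_num)
        (by positivity)
      have h6 : 1 / 2 * (1 / (15 * C * ρ)) ≤ v := by
        refine (hM.strictMonoOn.le_iff_le (mem_Ici.2 (by positivity)) hv0.le).1 ?_
        rw [hMv]
        linarith [hdiv h4]
      rw [show 1 / 2 * (1 / (15 * C * ρ)) = 1 / (30 * C * ρ) by field_simp; norm_num] at h6
      exact (one_div_le hv0 (by positivity)).2 h6
    have hle : 1 / v ≤ 30 * C * rearrangementMean p f t := by
      rw [← div_le_iff₀' (by positivity)]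
      refine le_of_forall_gt_imp_ge_of_dense fun ρ hρ => ?_
      rw [div_le_iff₀' (by positivity)]
      exact key ρ hρ
    rw [inv_mul_le_iff₀ (by positivity)]
    nlinarith [mul_nonneg hC.le (rearrangementMean_nonneg p f ht0 ht1)]
  · have h1 : orliczSeqNorm M ((Finset.range n : Set ℕ).indicator fun _ => 1) ≤ 1 / v := by
      refine hM.orliczSeqNorm_indicator_le hw0 ?_
      rw [Finset.sum_const, Finset.card_range, nsmul_eq_mul, abs_one, one_div_one_div, hMv]
      exact hnt
    have h2 : N ≤ C * (1 / v) := by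
      rw [inv_mul_le_iff₀ hC] at hlow
      exact hlow.trans (by gcongr)
    have h3 := hX.sum_quadPowModular_le_one hp1 hp2 hf hmean (by positivity) h2
    rw [Finset.sum_const, Finset.card_range, nsmul_eq_mul] at h3
    have h4 := quadPowModular_half_le hp1 hf (hdiv h3)
    have h5 := rearrangementMean_le_of_quadPowModular_le hp1 hp2 hf ht0 ht1
      (ρ := 1200 * C * (1 / v)) (by positivity)
      (by rwa [show (1200 * C * (1 / v))⁻¹ = 1 / (600 * (C * (1 / v))) / 2 by
        field_simp; norm_num])
    linarith

/-- Equivalence of `1 / M⁻¹` with the rearrangement mean gives mutual domination of `M` and of the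
modular of `f`, up to dilations, in the range where they are at most `1`. -/
lemma modular_domination (hp1 : 1 ≤ p) (hp2 : p ≤ 2)
    (hf : MemLp f (ENNReal.ofReal p) unitIntervalMeasure) {M : ℝ → ℝ} (hM : IsOrliczFunction M)
    {C : ℝ} (hC : 0 < C)
    (h : ∀ t ∈ Ioc (0 : ℝ) 1, C⁻¹ * (1 / orliczInverse M t) ≤ rearrangementMean p f t ∧
      rearrangementMean p f t ≤ C * (1 / orliczInverse M t)) :
    (∀ u, 0 ≤ u → M u ≤ 1 → quadPowModular p f (u / (2 * C)) ≤ M u) ∧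
      (∀ u, 0 ≤ u → quadPowModular p f u ≤ 1 → M (u / (3 * C)) ≤ quadPowModular p f u) := by
  constructor
  · intro u hu0 hu1
    rcases hu0.eq_or_lt with rfl | hu
    · simp [quadPowModular, quadPow_zero hp2, hM.map_zero]
    · have hMu : 0 < M u := by
        have := hM.strictMonoOn self_mem_Ici hu0 hu
        rwa [hM.map_zero] at this
      have h1 := (h (M u) ⟨hMu, hu1⟩).2
      rw [hM.orliczInverse_map hu0] at h1
      have h2 := quadPowModular_half_le hp1 hf
        (quadPowModular_le_of_rearrangementMean_le hp1 hf hMu hu1 (by positivity) h1)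
      rwa [show (C * (1 / u))⁻¹ / 2 = u / (2 * C) by field_simp] at h2
  · intro u hu0 hu1
    rcases hu0.eq_or_lt with rfl | hu
    · simpa [hM.map_zero] using quadPowModular_nonneg p f 0
    · have key : ∀ t, 0 < t → t ≤ 1 → quadPowModular p f u ≤ t → M (u / (3 * C)) ≤ t := by
        intro t ht0 ht1 ht
        have h1 := rearrangementMean_le_of_quadPowModular_le hp1 hp2 hf ht0 ht1
          (ρ := u⁻¹) (by positivity) (by rwa [inv_inv])
        have h2 := (h t ⟨ht0, ht1⟩).1
        have hv0 := hM.orliczInverse_pos ht0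
        rw [inv_mul_le_iff₀ hC] at h2
        have h3 : 1 / orliczInverse M t ≤ 3 * C / u := by
          calc _ ≤ C * (3 * u⁻¹) := h2.trans (by gcongr)
            _ = 3 * C / u := by field_simp
        rw [one_div_le hv0 (by positivity), one_div_div] at h3
        rw [← hM.map_orliczInverse ht0.le]
        exact hM.monotoneOn (mem_Ici.2 (by positivity)) hv0.le h3
      rcases (quadPowModular_nonneg p f u).eq_or_lt with h0 | h0
      · -- A vanishing modular is not in the range of the hypothesis; approximate it from above.
        rw [← h0]
        by_contra! hpos
        have := key (min 1 (M (u / (3 * C)) / 2)) (lt_min one_pos (by linarith)) (min_le_left _ _)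
          (by rw [← h0]; exact (lt_min one_pos (by linarith)).le)
        linarith [min_le_right 1 (M (u / (3 * C)) / 2)]
      · exact key _ h0 hu1 le_rfl

/-- The domination between `M` and the modular of `f` turns the two modular estimates for sums of
independent copies into an equivalence with the Luxemburg norm of `l_M`. -/
lemma IsIndependentCopies.norm_equiv_of_equivalentOn
    (hX : IsIndependentCopies X P f unitIntervalMeasure)
    (hp1 : 1 ≤ p) (hp2 : p ≤ 2) (hf : MemLp f (ENNReal.ofReal p) unitIntervalMeasure)
    (hmean : ∫ u, f u ∂unitIntervalMeasure = 0) {M : ℝ → ℝ} (hM : IsOrliczFunction M)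
    (h : EquivalentOn (Ioc (0 : ℝ) 1) (fun t => 1 / orliczInverse M t) (rearrangementMean p f)) :
    ∃ C : ℝ, 0 < C ∧ ∀ (s : Finset ℕ) (b : ℕ → ℝ),
      C⁻¹ * lpNormReal P p (fun ω => ∑ k ∈ s, b k * X k ω) ≤
          orliczSeqNorm M ((s : Set ℕ).indicator b) ∧
        orliczSeqNorm M ((s : Set ℕ).indicator b) ≤
          C * lpNormReal P p (fun ω => ∑ k ∈ s, b k * X k ω) := by
  obtain ⟨C, hC, h⟩ := h
  obtain ⟨hle, hge⟩ := modular_domination hp1 hp2 hf hM hC h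
  refine ⟨1800 * C, by positivity, fun s b => ?_⟩
  have hN0 := lpNormReal_nonneg (P := P) p (fun ω => ∑ k ∈ s, b k * X k ω)
  have hO0 := orliczSeqNorm_nonneg M ((s : Set ℕ).indicator b)
  set N := lpNormReal P p (fun ω => ∑ k ∈ s, b k * X k ω)
  set O := orliczSeqNorm M ((s : Set ℕ).indicator b)
  constructor
  · rw [inv_mul_le_iff₀ (by positivity), ← div_le_iff₀' (by positivity)]
    refine le_of_forall_gt_imp_ge_of_dense fun r hr => ?_
    have hr0 : 0 < r := hO0.trans_lt hr
    rw [div_le_iff₀' (by positivity)]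
    have h1 := hM.sum_le_one_of_orliczSeqNorm_lt hr
    have h2 : N ≤ 7 * (2 * C * r) := by
      refine hX.lpNormReal_le hp1 hp2 hf hmean (by positivity)
        (le_trans (Finset.sum_le_sum fun k hk => ?_) h1)
      have h3 : M (|b k| / r) ≤ 1 := le_trans
        (Finset.single_le_sum (f := fun k => M (|b k| / r))
          (fun k _ => hM.nonneg (by positivity)) hk) h1
      have h4 := hle (|b k| / r) (by positivity) h3
      rwa [← quadPowModular_abs, abs_div, abs_of_pos (by positivity : 0 < 2 * C * r),
        show |b k| / (2 * C * r) = |b k| / r / (2 * C) by field_simp]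
    nlinarith [mul_pos hC hr0]
  · rw [← div_le_iff₀' (by positivity)]
    refine le_of_forall_gt_imp_ge_of_dense fun r hr => ?_
    have hr0 : 0 < r := hN0.trans_lt hr
    rw [div_le_iff₀' (by positivity)]
    have h1 := hX.sum_quadPowModular_le_one hp1 hp2 hf hmean hr0 hr.le
    refine hM.orliczSeqNorm_indicator_le (by positivity)
      (le_trans (Finset.sum_le_sum fun k hk => ?_) h1)
    have h3 : quadPowModular p f (b k / (600 * r)) ≤ 1 := le_trans
      (Finset.single_le_sum (f := fun k => quadPowModular p f (b k / (600 * r)))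
        (fun k _ => quadPowModular_nonneg _ _ _) hk) h1
    rw [← quadPowModular_abs, abs_div, abs_of_pos (by positivity : 0 < 600 * r)] at h3 ⊢
    have h4 := hge _ (by positivity) h3
    rwa [show |b k| / (600 * r) / (3 * C) = |b k| / (1800 * C * r) by field_simp; ring] at h4

end Copies
end

theorem proposition2p3 (p : ℝ) (hp1 : 1 ≤ p) (hp2 : p ≤ 2)
    (M : ℝ → ℝ) (hM : IsOrliczFunction M)
    (f : ℝ → ℝ) (hf : MemLp f (ENNReal.ofReal p) unitIntervalMeasure)
    (hmean : ∫ u, f u ∂unitIntervalMeasure = 0)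
    {Ω : Type*} [MeasurableSpace Ω] (P : Measure Ω) [IsProbabilityMeasure P]
    (X : ℕ → Ω → ℝ) (hX : IsIndependentCopies X P f unitIntervalMeasure) :
    SequencesEquivalent (lpNormReal P p) X
        (orliczSeqNorm M) (fun n : ℕ => (Pi.single n (1 : ℝ) : ℕ → ℝ)) ↔
      EquivalentOn (Ioc (0 : ℝ) 1)
        (fun t => 1 / orliczInverse M t)
        (fun t =>
          ((1 / t) * ∫ s in (0 : ℝ)..t, decrRearrangement unitIntervalMeasure f s ^ p) ^ (1 / p) +
          ((1 / t) * ∫ s in t..(1 : ℝ),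
            decrRearrangement unitIntervalMeasure f s ^ (2 : ℝ)) ^ (1 / 2 : ℝ)) := by
  rw [sequencesEquivalent_iff]
  exact ⟨fun ⟨_, hC, h⟩ => hX.equivalentOn_of_norm_equiv hp1 hp2 hf hmean hM hC h,
    hX.norm_equiv_of_equivalentOn hp1 hp2 hf hmean hM⟩
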